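/- Let $(X,Y)$ be a pair of real random variables whose joint law is absolutely continuous with respect to Lebesgue measure on $\mathbb{R}^2$, with $\mathbb{E}[Y^2]<\infty$, and let $N\sim\mathcal N(0,1)$ be independent of $(X,Y)$. For $\gamma\ge 0$ put $Z_\gamma=\sqrt{\gamma}\,Y+N$. Let $I(\cdot\,;\cdot)$ denote mutual information with logarithms to any fixed base $b>1$ (bits for $b=2$), let $\mathrm{mmse}(U|V)=\mathbb{E}\big[(U-\mathbb{E}[U|V])^2\big]$, and for $\varepsilon\ge 0$ let $$g_\varepsilon(X,Y)=\max\{\,I(Y;Z_\gamma):\ \gamma\ge 0,\ I(X;Z_\gamma)\le\varepsilon\,\}.$$ Let $\varepsilon\in[0,I(X;Y))$ (where $I(X;Y)=\infty$ is allowed). Then there is a unique $\gamma_\varepsilon\in[0,\infty)$ with $I(X;Z_{\gamma_\varepsilon})=\varepsilon$; the maximum defining $g_\varepsilon(X,Y)$ is attained at $\gamma_\varepsilon$, so that $g_\varepsilon(X,Y)=I(Y;Z_{\gamma_\varepsilon})$, and it is finite; and the derivative of $\varepsilon\mapsto g_\varepsilon(X,Y)$ (at $\varepsilon=0$: the right derivative)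 exists in $[0,\infty]$ and is $$g'_\varepsilon(X,Y)=\frac{\mathrm{mmse}(Y|Z_{\gamma_\varepsilon})}{\mathrm{mmse}(Y|Z_{\gamma_\varepsilon})-\mathrm{mmse}(Y|Z_{\gamma_\varepsilon},X)}.$$ The denominator is strictly positive, so that the derivative is finite, whenever $\varepsilon>0$. At $\varepsilon=0$ the denominator is nonnegative; if it is zero, then the numerator is positive, the quotient is read as $+\infty$, and $g_\varepsilon(X,Y)/\varepsilon\to+\infty$ as $\varepsilon\downarrow 0$. -/

import Mathlib

open MeasureTheory ProbabilityTheory Filter Topology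
open scoped ENNReal

namespace RatePrivacy

noncomputable section

variable {Ω : Type*} [MeasurableSpace Ω] {α β : Type*} [MeasurableSpace α] [MeasurableSpace β]

/-- The mutual information `I(U;V)`, with logarithms to base `b`: the Kullback-Leibler divergence
(which Mathlib measures in nats) of the joint law from the product of the marginal laws, divided
by `log b`. It takes the value `∞` when the divergence is infinite. -/
def mutualInfo (b : ℝ) (U : Ω → α) (V : Ω → β) (μ : Measure Ω) : ℝ≥0∞ :=
  InformationTheory.klDiv (μ.map (fun ω => (U ω, V ω))) ((μ.map U).prod (μ.map V)) /
    ENNReal.ofReal (Real.log b)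

/-- `mmse(U|V) = E[(U - E[U|V])²]`. -/
def mmse (U : Ω → ℝ) (V : Ω → β) (μ : Measure Ω) : ℝ :=
  ∫ ω, (U ω - (μ[U | MeasurableSpace.comap V inferInstance]) ω) ^ 2 ∂μ

/-- The output `Z_γ = √γ Y + N` of the additive channel with noise `N` and
signal-to-noise ratio `γ`. -/
def channel (Y N : Ω → ℝ) (γ : ℝ) : Ω → ℝ := fun ω => Real.sqrt γ * Y ω + N ω

/-- The values `I(Y;Z_γ)`, over all `γ ≥ 0` such that `I(X;Z_γ) ≤ ε`. -/
def admissibleRates (b : ℝ) (X Y N : Ω → ℝ) (μ : Measure Ω) (ε : ℝ) : Set ℝ≥0∞ :=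
  {r | ∃ γ : ℝ, 0 ≤ γ ∧ mutualInfo b X (channel Y N γ) μ ≤ ENNReal.ofReal ε ∧
    r = mutualInfo b Y (channel Y N γ) μ}

/-- The rate-privacy function `g_ε(X,Y)` of the additive filter with noise `N`. -/
def ratePrivacy (b : ℝ) (X Y N : Ω → ℝ) (μ : Measure Ω) (ε : ℝ) : ℝ≥0∞ :=
  sSup (admissibleRates b X Y N μ ε)

end

end RatePrivacy

/-!
The proof rests on the relation between mutual information and mean square error. Write
`L_t(z)` for the density of `tY + N`, relative to the standard Gaussian law, and `L_t(z | v)` for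
its conditional version given side information `V = v`; both are Laplace-type integrals of the
likelihood `exp(tzy - t²y²/2)` against the law of `Y`, respectively its conditional law given `V`.
Then `I(V; tY + N) = E[log L_t(Z | V)] - E[log L_t(Z)]` with `Z = tY + N` (`mutualInfo_eq`), so that
only `t ↦ E[log L_t(tY + N | V)]` has to be differentiated, for `V = X`, `V = Y` and `V` constant.

Along the paths `t ↦ tY + N` this can be done under the expectation sign. The derivative of the
integrand is a combination of posterior moments of `Y`, and Bayes' formula (`condExp_out_side`)
turns its mean into `t E[E[Y | Z, V]²]`. The domination needs nothing beyond `E[Y²] < ∞`: the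
divergence of the posterior law from the prior law is nonnegative, which bounds the posterior second
moment by a quadratic function of the observation (`sq_mul_postMean_sq_le`). That bound degenerates
at `t = 0`, where the derivative in `γ = t²` is instead obtained as a limit of derivatives, with
Fatou's lemma for the mean square error (`tendsto_integral_condExp_sq`). The outcome is that
`dI(Y; Z_γ)/dγ` and `dI(X; Z_γ)/dγ` are, up to the same factor `1 / (2 log b)`, the numerator and the
denominator of the claim (`hasDerivWithinAt_realInfo`).

The denominator is `E[(E[Y | Z_γ, X] - E[Y | Z_γ])²]`. If it vanishes for some `γ > 0`, the posterior
means under almost all conditional laws of `Y` given `X` agree with those under the law of `Y`. A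
posterior mean is the derivative of a cumulant generating function, and so it determines the prior
(`eq_of_postMean_ae_eq`); hence `X` and `Y` are independent, contrary to `I(X;Y) > ε`. Therefore
`γ ↦ I(X; Z_γ)` is continuous and strictly increasing from `0`, and it exceeds every number below
`I(X;Y)` because the divergence is lower semicontinuous (`exists_lt_klDiv_out`, from its variational
formula). So `γ_ε` is unique, the maximum is attained there since `I(Y; Z_γ)` increases as well, and
`g` is `I(Y; Z_γ)` as a function of `I(X; Z_γ)`: its derivative is the quotient of the two
derivatives.
-/

namespace RatePrivacy

/-! ### Likelihood ratios of the Gaussian channel -/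

/-- The density `exp(tzy - t²y²/2)` at `z`, relative to the standard Gaussian law, of the law of
`ty + N`. -/
noncomputable def lik (t z y : ℝ) : ℝ := Real.exp (t * z * y - t ^ 2 * y ^ 2 / 2)

/-- The density at `z`, relative to the standard Gaussian law, of the law of `tY + N` when `Y` has
law `ν`. -/
noncomputable def outDens (ν : Measure ℝ) (t z : ℝ) : ℝ := ∫ y, lik t z y ∂ν

/-- The posterior mean of `f(Y)` given `tY + N = z`, when `Y` has the prior law `ν`. -/
noncomputable def postMean (ν : Measure ℝ) (t z : ℝ) (f : ℝ → ℝ) : ℝ :=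
  (∫ y, f y * lik t z y ∂ν) / outDens ν t z

/-- The derivative of `t ↦ log L_t(ty + u)` at the point where `ty + u = z`, with `L_t` the
density `outDens ν t`. -/
noncomputable def pathScore (ν : Measure ℝ) (t z y : ℝ) : ℝ :=
  (z + t * y) * postMean ν t z (fun x => x) - t * postMean ν t z (fun x => x ^ 2)

lemma lik_pos (t z y : ℝ) : 0 < lik t z y := Real.exp_pos _

lemma lik_le (t z y : ℝ) : lik t z y ≤ Real.exp (z ^ 2 / 2) := by
  refine Real.exp_le_exp.2 ?_
  nlinarith [sq_nonneg (z - t * y)]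

@[fun_prop]
lemma continuous_lik_right (t z : ℝ) : Continuous (lik t z) := by
  unfold lik; fun_prop

lemma integrable_mul_lik {ν : Measure ℝ} {f : ℝ → ℝ} (hf : Integrable f ν) (t z : ℝ) :
    Integrable (fun y => f y * lik t z y) ν := by
  refine hf.mul_bdd (c := Real.exp (z ^ 2 / 2))
    (continuous_lik_right t z).aestronglyMeasurable (ae_of_all _ fun y => ?_)
  rw [Real.norm_of_nonneg (lik_pos t z y).le]
  exact lik_le t z y

lemma integrable_lik (ν : Measure ℝ) [IsFiniteMeasure ν] (t z : ℝ) :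
    Integrable (lik t z) ν := by
  simpa using integrable_mul_lik (integrable_const (1 : ℝ) : Integrable (fun _ => (1 : ℝ)) ν) t z

section

variable (ν : Measure ℝ) [IsProbabilityMeasure ν]

lemma outDens_pos (t z : ℝ) : 0 < outDens ν t z :=
  integral_exp_pos (integrable_lik ν t z)

lemma outDens_le (t z : ℝ) : outDens ν t z ≤ Real.exp (z ^ 2 / 2) := by
  have := integral_mono (μ := ν) (integrable_lik ν t z) (integrable_const (Real.exp (z ^ 2 / 2)))
    (fun y => lik_le t z y)
  simpa [outDens] using this

lemma log_outDens_le (t z : ℝ) : Real.log (outDens ν t z) ≤ z ^ 2 / 2 :=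
  (Real.log_le_iff_le_exp (outDens_pos ν t z)).2 (outDens_le ν t z)

variable {ν} in
lemma integrable_of_sq (h : Integrable (fun y : ℝ => y ^ 2) ν) : Integrable (fun y : ℝ => y) ν :=
  ((memLp_two_iff_integrable_sq aestronglyMeasurable_id).2 h).integrable (by norm_num)

variable {ν} in
/-- Jensen's inequality. -/
lemma le_log_outDens (h : Integrable (fun y : ℝ => y ^ 2) ν) (t z : ℝ) :
    t * z * (∫ y, y ∂ν) - t ^ 2 * (∫ y, y ^ 2 ∂ν) / 2 ≤ Real.log (outDens ν t z) := by
  set a := t * z * (∫ y, y ∂ν) - t ^ 2 * (∫ y, y ^ 2 ∂ν) / 2 with ha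
  have h1 := integrable_of_sq h
  have hx : Integrable (fun y : ℝ => t * z * y - t ^ 2 * y ^ 2 / 2) ν :=
    (h1.const_mul _).sub ((h.const_mul _).div_const _)
  have hxa : ∫ y, (t * z * y - t ^ 2 * y ^ 2 / 2) ∂ν = a := by
    rw [integral_sub (h1.const_mul _) ((h.const_mul _).div_const _), integral_const_mul,
      integral_div, integral_const_mul]
  rw [Real.le_log_iff_exp_le (outDens_pos ν t z)]
  have hle : ∫ y, Real.exp a * ((t * z * y - t ^ 2 * y ^ 2 / 2) + (1 - a)) ∂ν ≤ outDens ν t z := by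
    refine integral_mono ?_ (integrable_lik ν t z) fun y => ?_
    · exact (hx.add (integrable_const _)).const_mul _
    · have := Real.add_one_le_exp ((t * z * y - t ^ 2 * y ^ 2 / 2) - a)
      calc Real.exp a * ((t * z * y - t ^ 2 * y ^ 2 / 2) + (1 - a))
          ≤ Real.exp a * Real.exp ((t * z * y - t ^ 2 * y ^ 2 / 2) - a) := by
            gcongr; linarith
        _ = lik t z y := by rw [← Real.exp_add, lik]; congr 1; ring
  rw [integral_const_mul, integral_add hx (integrable_const _), hxa] at hle
  simpa using hle

variable {ν} in
lemma neg_le_log_outDens (h : Integrable (fun y : ℝ => y ^ 2) ν) (t z : ℝ) :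
    -(z ^ 2 / 2 + t ^ 2 * ∫ y, y ^ 2 ∂ν) ≤ Real.log (outDens ν t z) := by
  refine le_trans ?_ (le_log_outDens h t z)
  have h1 := integrable_of_sq h
  have : ∫ y, (-(z ^ 2 / 2) - t ^ 2 * y ^ 2 / 2) ∂ν ≤ ∫ y, t * z * y ∂ν := by
    refine integral_mono ((integrable_const _).sub ((h.const_mul _).div_const _))
      (h1.const_mul _) fun y => ?_
    dsimp only
    nlinarith [sq_nonneg (z + t * y)]
  rw [integral_sub (integrable_const _) ((h.const_mul _).div_const _), integral_div,
    integral_const_mul, integral_const_mul] at this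
  simp at this
  linarith

variable {ν} in
lemma abs_log_outDens_le (h : Integrable (fun y : ℝ => y ^ 2) ν) (t z : ℝ) :
    |Real.log (outDens ν t z)| ≤ z ^ 2 / 2 + t ^ 2 * ∫ y, y ^ 2 ∂ν := by
  have h0 : 0 ≤ t ^ 2 * ∫ y, y ^ 2 ∂ν :=
    mul_nonneg (sq_nonneg _) (integral_nonneg fun y => sq_nonneg y)
  exact abs_le.2 ⟨neg_le_log_outDens h t z, (log_outDens_le ν t z).trans (by linarith)⟩

variable {ν} in
/-- The posterior second moment grows at most quadratically in the observation, with constants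
that depend on the prior through its second moment only. The bound comes from the nonnegativity
of the divergence of the posterior from the prior. -/
lemma sq_mul_postMean_sq_le (h : Integrable (fun y : ℝ => y ^ 2) ν) (t z : ℝ) :
    t ^ 2 * postMean ν t z (fun y => y ^ 2) ≤ 6 * z ^ 2 + 4 * t ^ 2 * ∫ y, y ^ 2 ∂ν := by
  set L := outDens ν t z with hL
  have hLpos : 0 < L := outDens_pos ν t z
  have hw := integrable_lik ν t z
  have hw2 := integrable_mul_lik h t z
  -- `w log w ≥ w log L + w - L` for the likelihood `w`, whose mean is `L`.
  have key : L * Real.log L ≤ z ^ 2 * L - t ^ 2 / 4 * ∫ y, y ^ 2 * lik t z y ∂ν := by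
    have h1 : ∫ y, (lik t z y * (Real.log L + 1) - L) ∂ν ≤
        ∫ y, (z ^ 2 * lik t z y - t ^ 2 / 4 * (y ^ 2 * lik t z y)) ∂ν := by
      refine integral_mono ((hw.mul_const _).sub (integrable_const _))
        ((hw.const_mul _).sub (hw2.const_mul _)) fun y => ?_
      dsimp only
      have hp := lik_pos t z y
      have h2 : Real.log (L / lik t z y) ≤ L / lik t z y - 1 :=
        Real.log_le_sub_one_of_pos (div_pos hLpos hp)
      rw [Real.log_div hLpos.ne' hp.ne'] at h2
      have h3 : Real.log (lik t z y) ≤ z ^ 2 - t ^ 2 / 4 * y ^ 2 := by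
        rw [lik, Real.log_exp]
        nlinarith [sq_nonneg (z - t * y / 2)]
      have h4 := mul_le_mul_of_nonneg_left h2 hp.le
      have h5 := mul_le_mul_of_nonneg_left h3 hp.le
      have h6 : lik t z y * (L / lik t z y - 1) = L - lik t z y := by field_simp
      rw [h6] at h4
      nlinarith
    rw [integral_sub (hw.mul_const _) (integrable_const _), integral_mul_const,
      integral_sub (hw.const_mul _) (hw2.const_mul _), integral_const_mul,
      integral_const_mul] at h1
    simp only [integral_const, probReal_univ, one_smul] at h1
    change L * (Real.log L + 1) - L ≤ z ^ 2 * L - _ at h1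
    linarith
  have h7 := neg_le_log_outDens h t z
  rw [← hL] at h7
  have h8 : (∫ y, y ^ 2 * lik t z y ∂ν) = postMean ν t z (fun y => y ^ 2) * L := by
    rw [postMean, div_mul_cancel₀ _ hLpos.ne']
  rw [h8] at key
  have h9 : Real.log L ≤ z ^ 2 - t ^ 2 / 4 * postMean ν t z (fun y => y ^ 2) := by
    refine le_of_mul_le_mul_left ?_ hLpos
    linarith
  linarith

lemma postMean_sq_nonneg (t z : ℝ) : 0 ≤ postMean ν t z (fun y => y ^ 2) :=
  div_nonneg (integral_nonneg fun y => mul_nonneg (sq_nonneg y) (lik_pos t z y).le)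
    (outDens_pos ν t z).le

variable {ν} in
lemma abs_mul_postMean_le (h : Integrable (fun y : ℝ => y ^ 2) ν) (t z c : ℝ) :
    |c * postMean ν t z (fun y => y)| ≤ c ^ 2 / 2 + postMean ν t z (fun y => y ^ 2) / 2 := by
  have h1 := integrable_of_sq h
  have hLpos := outDens_pos ν t z
  have hw := integrable_lik ν t z
  have hw1 := integrable_mul_lik h1 t z
  have hw2 := integrable_mul_lik h t z
  have hb : |∫ y, c * (y * lik t z y) ∂ν| ≤
      ∫ y, (c ^ 2 / 2 * lik t z y + (1 / 2) * (y ^ 2 * lik t z y)) ∂ν := by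
    rw [← Real.norm_eq_abs]
    refine norm_integral_le_of_norm_le ((hw.const_mul _).add (hw2.const_mul _))
      (ae_of_all _ fun y => ?_)
    have hp := lik_pos t z y
    rw [Real.norm_eq_abs, ← mul_assoc, abs_mul, abs_of_pos hp]
    have : |c * y| ≤ c ^ 2 / 2 + y ^ 2 / 2 :=
      abs_le.2 ⟨by nlinarith [sq_nonneg (c + y)], by nlinarith [sq_nonneg (c - y)]⟩
    nlinarith
  rw [integral_const_mul, integral_add (hw.const_mul _) (hw2.const_mul _), integral_const_mul,
    integral_const_mul] at hb
  rw [postMean, postMean, ← mul_div_assoc, abs_div, abs_of_pos hLpos, div_le_iff₀ hLpos]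
  refine hb.trans (le_of_eq ?_)
  change c ^ 2 / 2 * outDens ν t z + _ = _
  field_simp

variable {ν} in
lemma abs_pathScore_le (h : Integrable (fun y : ℝ => y ^ 2) ν) {t : ℝ} (ht : 0 ≤ t) (z y : ℝ) :
    |pathScore ν t z y| ≤
      (z + t * y) ^ 2 / 2 + (1 / 2 + t) * postMean ν t z (fun x => x ^ 2) := by
  have h1 := abs_mul_postMean_le h t z (z + t * y)
  have h2 := mul_nonneg ht (postMean_sq_nonneg ν t z)
  have h3 := abs_le.1 h1
  rw [pathScore]
  exact abs_le.2 ⟨by linarith [h3.1], by linarith [h3.2]⟩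

variable {ν} in
lemma hasDerivAt_log_outDens (h : Integrable (fun y : ℝ => y ^ 2) ν) (y u t₀ : ℝ) :
    HasDerivAt (fun t => Real.log (outDens ν t (t * y + u)))
      (pathScore ν t₀ (t₀ * y + u) y) t₀ := by
  have h1 := integrable_of_sq h
  have hLpos := outDens_pos ν t₀ (t₀ * y + u)
  set R := |t₀| + 1 with hR
  set B := 2 * R * |y| + |u| with hB
  have hR1 : 1 ≤ R := by have := abs_nonneg t₀; linarith
  have hB0 : 0 ≤ B := by positivity
  have key := (hasDerivAt_integral_of_dominated_loc_of_deriv_le (μ := ν) (x₀ := t₀)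
    (s := Metric.ball t₀ 1)
    (F := fun t x => lik t (t * y + u) x)
    (F' := fun t x => ((2 * t * y + u) * x - t * x ^ 2) * lik t (t * y + u) x)
    (bound := fun x => (B * |x| + R * x ^ 2) * Real.exp (B ^ 2 / 2))
    (Metric.ball_mem_nhds _ one_pos)
    (Eventually.of_forall fun t => (continuous_lik_right _ _).aestronglyMeasurable)
    (integrable_lik ν _ _) ?_ ?_ ?_ ?_).2
  · have h2 : ∫ x, ((2 * t₀ * y + u) * x - t₀ * x ^ 2) * lik t₀ (t₀ * y + u) x ∂ν =
        (2 * t₀ * y + u) * (∫ x, x * lik t₀ (t₀ * y + u) x ∂ν) -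
          t₀ * ∫ x, x ^ 2 * lik t₀ (t₀ * y + u) x ∂ν := by
      rw [← integral_const_mul, ← integral_const_mul, ← integral_sub
        ((integrable_mul_lik h1 _ _).const_mul _) ((integrable_mul_lik h _ _).const_mul _)]
      congr 1; ext x; ring
    rw [h2] at key
    have := key.log hLpos.ne'
    convert! this using 1
    rw [pathScore, postMean, postMean, outDens]
    ring
  · fun_prop
  · refine ae_of_all _ fun x t ht => ?_
    have ht' : |t| ≤ R := by
      have := abs_sub_abs_le_abs_sub t t₀
      rw [Metric.mem_ball, Real.dist_eq] at ht
      linarith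
    have hz : |t * y + u| ≤ B := by
      refine (abs_add_le _ _).trans ?_
      rw [abs_mul]
      have := mul_le_mul_of_nonneg_right ht' (abs_nonneg y)
      have := mul_nonneg (zero_le_one.trans hR1) (abs_nonneg y)
      rw [hB]; linarith
    have hz2 : |2 * t * y + u| ≤ B := by
      refine (abs_add_le _ _).trans ?_
      rw [abs_mul, abs_mul, abs_two, hB]
      gcongr
    rw [norm_mul, Real.norm_of_nonneg (lik_pos _ _ _).le, Real.norm_eq_abs]
    refine mul_le_mul ?_ ((lik_le _ _ _).trans ?_) (lik_pos _ _ _).le (by positivity)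
    · refine (abs_sub _ _).trans ?_
      rw [abs_mul, abs_mul, abs_of_nonneg (sq_nonneg x)]
      gcongr
    · have := sq_le_sq' (neg_le_of_abs_le hz) (le_of_abs_le hz)
      gcongr
  · exact ((h1.abs.const_mul _).add (h.const_mul _)).mul_const _
  · refine ae_of_all _ fun x t _ => ?_
    have hd : HasDerivAt (fun t : ℝ => t * (t * y + u) * x - t ^ 2 * x ^ 2 / 2)
        ((2 * t * y + u) * x - t * x ^ 2) t := by
      have h3 := (((hasDerivAt_id t).mul (((hasDerivAt_id t).mul_const y).add_const u)).mul_const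
        x).sub ((((hasDerivAt_id t).pow 2).mul_const (x ^ 2)).div_const 2)
      convert! h3 using 1
      simp; ring
    have := hd.exp
    convert! this using 1
    rw [lik]; ring

end

/-! ### Joint law and posterior of the Gaussian channel with side information -/

/-- The density of a shifted Gaussian law relative to the centred one. -/
lemma lintegral_gaussianReal_add (c : ℝ) {f : ℝ → ℝ≥0∞} (hf : Measurable f) :
    ∫⁻ n, f (c + n) ∂gaussianReal 0 1 =
      ∫⁻ z, ENNReal.ofReal (Real.exp (c * z - c ^ 2 / 2)) * f z ∂gaussianReal 0 1 := by
  have h1 : ∫⁻ n, f (c + n) ∂gaussianReal 0 1 = ∫⁻ z, f z ∂gaussianReal c 1 := by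
    have h := gaussianReal_map_const_add (μ := 0) (v := 1) c
    rw [zero_add] at h
    rw [← h, lintegral_map hf (by fun_prop)]
  rw [h1, gaussianReal_of_var_ne_zero _ one_ne_zero, gaussianReal_of_var_ne_zero _ one_ne_zero,
    lintegral_withDensity_eq_lintegral_mul _ (measurable_gaussianPDF _ _) hf,
    lintegral_withDensity_eq_lintegral_mul _ (measurable_gaussianPDF _ _) (by fun_prop)]
  refine lintegral_congr fun z => ?_
  simp only [Pi.mul_apply, ← mul_assoc]
  congr 1
  rw [gaussianPDF, gaussianPDF, ← ENNReal.ofReal_mul (gaussianPDFReal_nonneg _ _ _)]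
  congr 1
  simp only [gaussianPDFReal]
  rw [mul_assoc _ (Real.exp _) (Real.exp _), ← Real.exp_add]
  congr 2
  simp
  ring

lemma measurable_outDens {α : Type*} [MeasurableSpace α] (κ : Kernel α ℝ) [IsSFiniteKernel κ] :
    Measurable fun p : ℝ × ℝ × α => outDens (κ p.2.2) p.1 p.2.1 := by
  have h : StronglyMeasurable fun q : (ℝ × ℝ × α) × ℝ => lik q.1.1 q.1.2.1 q.2 := by
    apply Measurable.stronglyMeasurable
    unfold lik
    fun_prop
  exact (h.integral_kernel_prod_right' (κ := κ.comap (fun p : ℝ × ℝ × α => p.2.2)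
    (by fun_prop))).measurable

lemma measurable_postMean {α : Type*} [MeasurableSpace α] (κ : Kernel α ℝ) [IsSFiniteKernel κ]
    {f : ℝ → ℝ} (hf : Measurable f) :
    Measurable fun p : ℝ × ℝ × α => postMean (κ p.2.2) p.1 p.2.1 f := by
  have h : StronglyMeasurable fun q : (ℝ × ℝ × α) × ℝ => f q.2 * lik q.1.1 q.1.2.1 q.2 := by
    apply Measurable.stronglyMeasurable
    unfold lik
    fun_prop
  exact (h.integral_kernel_prod_right' (κ := κ.comap (fun p : ℝ × ℝ × α => p.2.2)
    (by fun_prop))).measurable.div (measurable_outDens κ)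

/-- A square-integrable input `Y` with side information `V`, and a standard Gaussian noise `N`
that is independent of `(V, Y)`. -/
structure GaussianInput {Ω : Type*} [MeasurableSpace Ω] (μ : Measure Ω) (V Y N : Ω → ℝ) :
    Prop where
  measurable_side : Measurable V
  measurable_input : Measurable Y
  measurable_noise : Measurable N
  memLp_input : MemLp Y 2 μ
  map_noise : μ.map N = gaussianReal 0 1
  indep : IndepFun (fun ω => (V ω, Y ω)) N μ

/-- The posterior law of `Y` given `(tY + N, V) = (z, v)`, when `κ` is the conditional law of
`Y` given `V`. -/
noncomputable def posteriorKernel (κ : Kernel ℝ ℝ) [IsSFiniteKernel κ] (t : ℝ) : Kernel (ℝ × ℝ) ℝ :=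
  (κ.prodMkLeft ℝ).withDensity
    fun p y => ENNReal.ofReal (lik t p.1 y / outDens (κ p.2) t p.1)

section

variable (κ : Kernel ℝ ℝ) [IsMarkovKernel κ] (t : ℝ)

lemma measurable_outDens_pair : Measurable fun p : ℝ × ℝ => outDens (κ p.2) t p.1 :=
  (measurable_outDens κ).comp (measurable_const.prodMk measurable_id)

lemma measurable_postMean_pair {f : ℝ → ℝ} (hf : Measurable f) :
    Measurable fun p : ℝ × ℝ => postMean (κ p.2) t p.1 f :=
  (measurable_postMean κ hf).comp (measurable_const.prodMk measurable_id)

lemma measurable_lik_pair : Measurable fun q : (ℝ × ℝ) × ℝ => lik t q.1.1 q.2 := by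
  unfold lik; fun_prop

lemma measurable_posterior_density :
    Measurable (Function.uncurry fun (p : ℝ × ℝ) (y : ℝ) =>
      ENNReal.ofReal (lik t p.1 y / outDens (κ p.2) t p.1)) :=
  ((measurable_lik_pair t).div ((measurable_outDens_pair κ t).comp measurable_fst)).ennreal_ofReal

lemma lintegral_lik (p : ℝ × ℝ) :
    ∫⁻ y, ENNReal.ofReal (lik t p.1 y) ∂κ p.2 = ENNReal.ofReal (outDens (κ p.2) t p.1) :=
  (ofReal_integral_eq_lintegral_ofReal (integrable_lik _ _ _)
    (ae_of_all _ fun y => (lik_pos t p.1 y).le)).symm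

lemma lintegral_posteriorKernel (p : ℝ × ℝ) {g : ℝ → ℝ≥0∞} (hg : Measurable g) :
    ∫⁻ y, g y ∂posteriorKernel κ t p =
      (ENNReal.ofReal (outDens (κ p.2) t p.1))⁻¹ *
        ∫⁻ y, ENNReal.ofReal (lik t p.1 y) * g y ∂κ p.2 := by
  rw [posteriorKernel, Kernel.lintegral_withDensity _ (measurable_posterior_density κ t) _ hg,
    Kernel.prodMkLeft_apply, ← lintegral_const_mul _ (by unfold lik; fun_prop)]
  refine lintegral_congr fun y => ?_
  rw [ENNReal.ofReal_div_of_pos (outDens_pos _ _ _), ENNReal.div_eq_inv_mul, mul_assoc]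

instance : IsMarkovKernel (posteriorKernel κ t) := by
  refine ⟨fun p => ⟨?_⟩⟩
  have h := lintegral_posteriorKernel κ t p (g := fun _ => 1) measurable_const
  simp only [lintegral_const, one_mul, mul_one, lintegral_lik] at h
  rw [h]
  exact ENNReal.inv_mul_cancel (by simpa using outDens_pos _ _ _) ENNReal.ofReal_ne_top

lemma integral_posteriorKernel (p : ℝ × ℝ) (f : ℝ → ℝ) :
    ∫ y, f y ∂posteriorKernel κ t p = postMean (κ p.2) t p.1 f := by
  have hm : Measurable fun y => lik t p.1 y / outDens (κ p.2) t p.1 := by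
    unfold lik; fun_prop
  rw [posteriorKernel, Kernel.withDensity_apply _ (measurable_posterior_density κ t),
    Kernel.prodMkLeft_apply, integral_withDensity_eq_integral_toReal_smul (by fun_prop) (by simp),
    postMean, ← integral_div]
  congr 1
  ext y
  rw [ENNReal.toReal_ofReal (div_nonneg (lik_pos _ _ _).le (outDens_pos _ _ _).le), smul_eq_mul]
  ring

end

namespace GaussianInput

variable {Ω : Type*} [MeasurableSpace Ω] {μ : Measure Ω} {V Y N : Ω → ℝ}

lemma measurable_out (h : GaussianInput μ V Y N) (t : ℝ) :
    Measurable fun ω => t * Y ω + N ω :=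
  (h.measurable_input.const_mul t).add h.measurable_noise

variable [IsProbabilityMeasure μ]

/-- The joint law of `((Z, V), Y)` has density `lik` relative to the law under which `Z` is standard
Gaussian and independent of `(V, Y)`. -/
lemma lintegral_joint (h : GaussianInput μ V Y N) (t : ℝ) {g : (ℝ × ℝ) × ℝ → ℝ≥0∞}
    (hg : Measurable g) :
    ∫⁻ ω, g ((t * Y ω + N ω, V ω), Y ω) ∂μ =
      ∫⁻ p, ∫⁻ y, ENNReal.ofReal (lik t p.1 y) * g (p, y) ∂(condDistrib Y V μ p.2)
        ∂((gaussianReal 0 1).prod (μ.map V)) := by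
  have hlik := measurable_lik_pair t
  have hVY := h.measurable_side.prodMk h.measurable_input
  have hlaw := (indepFun_iff_map_prod_eq_prod_map_map hVY.aemeasurable
    h.measurable_noise.aemeasurable).1 h.indep
  have h1 : ∫⁻ ω, g ((t * Y ω + N ω, V ω), Y ω) ∂μ =
      ∫⁻ q, g ((t * q.1.2 + q.2, q.1.1), q.1.2) ∂(μ.map fun ω => ((V ω, Y ω), N ω)) := by
    rw [lintegral_map (by fun_prop) (hVY.prodMk h.measurable_noise)]
  have := Measure.isProbabilityMeasure_map (μ := μ) h.measurable_side.aemeasurable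
  rw [h1, hlaw, h.map_noise, lintegral_prod _ (by fun_prop),
    ← compProd_map_condDistrib h.measurable_input.aemeasurable]
  have h2 : ∀ q : ℝ × ℝ, ∫⁻ n, g ((t * q.2 + n, q.1), q.2) ∂gaussianReal 0 1 =
      ∫⁻ z, ENNReal.ofReal (lik t z q.2) * g ((z, q.1), q.2) ∂gaussianReal 0 1 := by
    intro q
    rw [lintegral_gaussianReal_add (t * q.2) (f := fun z => g ((z, q.1), q.2)) (by fun_prop)]
    refine lintegral_congr fun z => ?_
    congr 3
    ring
  simp_rw [h2]
  have hG : Measurable fun q : (ℝ × ℝ) × ℝ => ENNReal.ofReal (lik t q.1.1 q.2) * g q :=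
    hlik.ennreal_ofReal.mul hg
  have hG' : Measurable fun r : (ℝ × ℝ) × ℝ =>
      ENNReal.ofReal (lik t r.2 r.1.2) * g ((r.2, r.1.1), r.1.2) :=
    hG.comp (by fun_prop : Measurable fun r : (ℝ × ℝ) × ℝ => ((r.2, r.1.1), r.1.2))
  rw [Measure.lintegral_compProd hG'.lintegral_prod_right']
  have hmeas : Measurable fun p : ℝ × ℝ =>
      ∫⁻ y, ENNReal.ofReal (lik t p.1 y) * g (p, y) ∂(condDistrib Y V μ p.2) :=
    hG.lintegral_kernel_prod_right' (κ := (condDistrib Y V μ).prodMkLeft ℝ)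
  rw [lintegral_prod_symm _ hmeas.aemeasurable]
  refine lintegral_congr fun v => ?_
  rw [lintegral_lintegral_swap]
  exact (hG.comp (by fun_prop : Measurable fun r : ℝ × ℝ => ((r.2, v), r.1))).aemeasurable

lemma map_out_side (h : GaussianInput μ V Y N) (t : ℝ) :
    μ.map (fun ω => (t * Y ω + N ω, V ω)) =
      ((gaussianReal 0 1).prod (μ.map V)).withDensity
        fun p => ENNReal.ofReal (outDens (condDistrib Y V μ p.2) t p.1) := by
  refine Measure.ext_of_lintegral _ fun g hg => ?_
  rw [lintegral_map hg ((h.measurable_out t).prodMk h.measurable_side),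
    h.lintegral_joint t (g := fun q => g q.1) (by fun_prop),
    lintegral_withDensity_eq_lintegral_mul _ (measurable_outDens_pair _ t).ennreal_ofReal hg]
  refine lintegral_congr fun p => ?_
  dsimp only
  rw [lintegral_mul_const _ (by unfold lik; fun_prop), lintegral_lik, Pi.mul_apply]

lemma condDistrib_out_side (h : GaussianInput μ V Y N) (t : ℝ) :
    condDistrib Y (fun ω => (t * Y ω + N ω, V ω)) μ
      =ᵐ[μ.map fun ω => (t * Y ω + N ω, V ω)] posteriorKernel (condDistrib Y V μ) t := by
  have hW := (h.measurable_out t).prodMk h.measurable_side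
  refine condDistrib_ae_eq_of_measure_eq_compProd_of_measurable hW h.measurable_input ?_
  refine Measure.ext_of_lintegral _ fun g hg => ?_
  rw [lintegral_map hg (hW.prodMk h.measurable_input), h.lintegral_joint t hg,
    Measure.lintegral_compProd hg, h.map_out_side t,
    lintegral_withDensity_eq_lintegral_mul _ (measurable_outDens_pair _ t).ennreal_ofReal
      (hg.lintegral_kernel_prod_right' (κ := posteriorKernel (condDistrib Y V μ) t))]
  refine lintegral_congr fun p => ?_
  rw [Pi.mul_apply, lintegral_posteriorKernel _ _ _ (by fun_prop), ← mul_assoc,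
    ENNReal.mul_inv_cancel (by simpa using outDens_pos _ _ _) ENNReal.ofReal_ne_top, one_mul]

/-- **Bayes' formula** for the Gaussian channel with side information. -/
lemma condExp_out_side (h : GaussianInput μ V Y N) (t : ℝ) {f : ℝ → ℝ} (hf : Measurable f)
    (hfY : Integrable (fun ω => f (Y ω)) μ) :
    μ[fun ω => f (Y ω) |
        MeasurableSpace.comap (fun ω => (t * Y ω + N ω, V ω)) inferInstance] =ᵐ[μ]
      fun ω => postMean (condDistrib Y V μ (V ω)) t (t * Y ω + N ω) f := by
  have hW := (h.measurable_out t).prodMk h.measurable_side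
  refine (condExp_ae_eq_integral_condDistrib hW h.measurable_input.aemeasurable
    hf.stronglyMeasurable hfY).trans ?_
  filter_upwards [ae_of_ae_map hW.aemeasurable (h.condDistrib_out_side t)] with ω hω
  rw [hω, integral_posteriorKernel]

end GaussianInput

/-! ### Second moments of conditional expectations -/

section CondExp

variable {Ω : Type*} {mΩ : MeasurableSpace Ω} {μ : Measure Ω}
  {m m₁ m₂ : MeasurableSpace Ω} {Y : Ω → ℝ}

lemma memLp_condExp (hY : MemLp Y 2 μ) : MemLp (μ[Y | m]) 2 μ :=
  MemLp.condExp one_le_two hY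

variable [IsProbabilityMeasure μ]

lemma integral_mul_condExp (hm : m ≤ mΩ) (hY : MemLp Y 2 μ) {g : Ω → ℝ}
    (hgm : StronglyMeasurable[m] g) (hg : MemLp g 2 μ) :
    ∫ ω, g ω * (μ[Y | m]) ω ∂μ = ∫ ω, g ω * Y ω ∂μ := by
  have h := condExp_mul_of_stronglyMeasurable_left hgm (hg.integrable_mul hY)
    (hY.integrable one_le_two)
  have h2 := integral_condExp (μ := μ) (f := g * Y) hm
  rw [integral_congr_ae h] at h2
  exact h2

lemma integral_condExp_sq (hm : m ≤ mΩ) (hY : MemLp Y 2 μ) :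
    ∫ ω, (μ[Y | m]) ω * Y ω ∂μ = ∫ ω, (μ[Y | m]) ω ^ 2 ∂μ := by
  rw [← integral_mul_condExp hm hY stronglyMeasurable_condExp (memLp_condExp hY)]
  simp_rw [sq]

lemma integral_sub_condExp_sq (hm : m ≤ mΩ) (hY : MemLp Y 2 μ) :
    ∫ ω, (Y ω - (μ[Y | m]) ω) ^ 2 ∂μ = ∫ ω, Y ω ^ 2 ∂μ - ∫ ω, (μ[Y | m]) ω ^ 2 ∂μ := by
  have hE := memLp_condExp (m := m) hY
  have h1 : Integrable (fun ω => 2 * ((μ[Y | m]) ω * Y ω)) μ := (hE.integrable_mul hY).const_mul 2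
  calc ∫ ω, (Y ω - (μ[Y | m]) ω) ^ 2 ∂μ
      = ∫ ω, (Y ω ^ 2 - 2 * ((μ[Y | m]) ω * Y ω) + (μ[Y | m]) ω ^ 2) ∂μ := by
        congr 1; ext ω; ring
    _ = _ := by
        have h2 : Integrable (fun ω => Y ω ^ 2 - 2 * ((μ[Y | m]) ω * Y ω)) μ :=
          hY.integrable_sq.sub h1
        rw [integral_add h2 hE.integrable_sq,
          integral_sub hY.integrable_sq h1, integral_const_mul, integral_condExp_sq hm hY]
        ring

/-- Pythagoras' theorem for two nested conditional expectations. -/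
lemma integral_condExp_sub_sq (h12 : m₁ ≤ m₂) (h2 : m₂ ≤ mΩ) (hY : MemLp Y 2 μ) :
    ∫ ω, ((μ[Y | m₂]) ω - (μ[Y | m₁]) ω) ^ 2 ∂μ =
      ∫ ω, (μ[Y | m₂]) ω ^ 2 ∂μ - ∫ ω, (μ[Y | m₁]) ω ^ 2 ∂μ := by
  have hE1 := memLp_condExp (m := m₁) hY
  have hE2 := memLp_condExp (m := m₂) hY
  have hI : Integrable (fun ω => 2 * ((μ[Y | m₁]) ω * (μ[Y | m₂]) ω)) μ :=
    (hE1.integrable_mul hE2).const_mul 2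
  calc ∫ ω, ((μ[Y | m₂]) ω - (μ[Y | m₁]) ω) ^ 2 ∂μ
      = ∫ ω, ((μ[Y | m₂]) ω ^ 2 - 2 * ((μ[Y | m₁]) ω * (μ[Y | m₂]) ω) +
          (μ[Y | m₁]) ω ^ 2) ∂μ := by
        congr 1; ext ω; ring
    _ = _ := by
        have h3 : Integrable (fun ω => (μ[Y | m₂]) ω ^ 2 -
            2 * ((μ[Y | m₁]) ω * (μ[Y | m₂]) ω)) μ := hE2.integrable_sq.sub hI
        rw [integral_add h3 hE1.integrable_sq,
          integral_sub hE2.integrable_sq hI, integral_const_mul,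
          integral_mul_condExp h2 hY (stronglyMeasurable_condExp.mono h12) hE1,
          integral_condExp_sq (h12.trans h2) hY]
        ring

end CondExp

/-! ### Derivative of the mean log-likelihood ratio -/

/-- The mean of `log L(tY + N)`, with `L` the density of `tY + N` given `V`, relative to the
standard Gaussian law. -/
noncomputable def meanLogDens {Ω : Type*} [MeasurableSpace Ω] (μ : Measure Ω) [IsFiniteMeasure μ]
    (V Y N : Ω → ℝ) (t : ℝ) : ℝ :=
  ∫ ω, Real.log (outDens (condDistrib Y V μ (V ω)) t (t * Y ω + N ω)) ∂μ

/-- The sigma-algebra generated by the observation `tY + N` and the side information `V`. -/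
abbrev obsAlg {Ω : Type*} (V Y N : Ω → ℝ) (t : ℝ) : MeasurableSpace Ω :=
  MeasurableSpace.comap (fun ω => (t * Y ω + N ω, V ω)) inferInstance

namespace GaussianInput

variable {Ω : Type*} [MeasurableSpace Ω] {μ : Measure Ω} {V Y N : Ω → ℝ}

lemma obsAlg_le (h : GaussianInput μ V Y N) (t : ℝ) :
    obsAlg V Y N t ≤ ‹MeasurableSpace Ω› :=
  ((h.measurable_out t).prodMk h.measurable_side).comap_le

lemma memLp_noise (h : GaussianInput μ V Y N) : MemLp N 2 μ := by
  have h1 : MemLp id 2 (μ.map N) := by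
    rw [h.map_noise]; exact memLp_id_gaussianReal 2
  exact h1.comp_of_map h.measurable_noise.aemeasurable

lemma memLp_out (h : GaussianInput μ V Y N) (t : ℝ) : MemLp (fun ω => t * Y ω + N ω) 2 μ :=
  (h.memLp_input.const_mul t).add h.memLp_noise

lemma integral_noise (h : GaussianInput μ V Y N) : ∫ ω, N ω ∂μ = 0 := by
  have h1 : ∫ x, x ∂(μ.map N) = ∫ ω, N ω ∂μ :=
    integral_map h.measurable_noise.aemeasurable aestronglyMeasurable_id
  rw [← h1, h.map_noise, integral_id_gaussianReal]

lemma integral_mul_noise (h : GaussianInput μ V Y N) : ∫ ω, Y ω * N ω ∂μ = 0 := by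
  have h1 : IndepFun Y N μ := h.indep.comp measurable_snd measurable_id
  rw [h1.integral_fun_mul_eq_mul_integral h.measurable_input.aestronglyMeasurable
    h.measurable_noise.aestronglyMeasurable, h.integral_noise, mul_zero]

variable [IsProbabilityMeasure μ]

lemma ae_integrable_sq (h : GaussianInput μ V Y N) :
    ∀ᵐ ω ∂μ, Integrable (fun y => y ^ 2) (condDistrib Y V μ (V ω)) := by
  refine Integrable.condDistrib_ae (f := fun p : ℝ × ℝ => p.2 ^ 2)
    h.measurable_side.aemeasurable h.measurable_input.aemeasurable ?_
  rw [integrable_map_measure (by fun_prop)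
    (h.measurable_side.prodMk h.measurable_input).aemeasurable]
  exact h.memLp_input.integrable_sq

lemma integrable_condSq (h : GaussianInput μ V Y N) :
    Integrable (fun ω => ∫ y, y ^ 2 ∂condDistrib Y V μ (V ω)) μ := by
  refine Integrable.integral_condDistrib (f := fun p : ℝ × ℝ => p.2 ^ 2)
    h.measurable_side.aemeasurable h.measurable_input.aemeasurable ?_
  rw [integrable_map_measure (by fun_prop)
    (h.measurable_side.prodMk h.measurable_input).aemeasurable]
  exact h.memLp_input.integrable_sq

lemma measurable_outDens_out (h : GaussianInput μ V Y N) (t : ℝ) :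
    Measurable fun ω => outDens (condDistrib Y V μ (V ω)) t (t * Y ω + N ω) :=
  (measurable_outDens_pair _ t).comp ((h.measurable_out t).prodMk h.measurable_side)

lemma measurable_postMean_out (h : GaussianInput μ V Y N) (t : ℝ) {f : ℝ → ℝ}
    (hf : Measurable f) :
    Measurable fun ω => postMean (condDistrib Y V μ (V ω)) t (t * Y ω + N ω) f :=
  (measurable_postMean_pair _ t hf).comp ((h.measurable_out t).prodMk h.measurable_side)

lemma integrable_log_outDens (h : GaussianInput μ V Y N) (t : ℝ) :
    Integrable
      (fun ω => Real.log (outDens (condDistrib Y V μ (V ω)) t (t * Y ω + N ω))) μ := by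
  refine Integrable.mono' (((h.memLp_out t).integrable_sq.div_const 2).add
    (h.integrable_condSq.const_mul (t ^ 2)))
    (h.measurable_outDens_out t).log.aestronglyMeasurable ?_
  filter_upwards [h.ae_integrable_sq] with ω hω
  exact abs_log_outDens_le hω _ _

lemma condExp_eq_postMean (h : GaussianInput μ V Y N) (t : ℝ) :
    μ[Y | obsAlg V Y N t] =ᵐ[μ]
      fun ω => postMean (condDistrib Y V μ (V ω)) t (t * Y ω + N ω) (fun y => y) :=
  h.condExp_out_side t measurable_id (h.memLp_input.integrable one_le_two)

/-- By Bayes' formula the mean of the path derivative is `E[Z E[Y|Z,V]] + t E[Y E[Y|Z,V]] - t E[Y²]`,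
and `E[ZY] = t E[Y²]` because the noise is centred and independent of `Y`. -/
lemma integral_pathScore (h : GaussianInput μ V Y N) (t : ℝ) :
    ∫ ω, pathScore (condDistrib Y V μ (V ω)) t (t * Y ω + N ω) (Y ω) ∂μ =
      t * ∫ ω, (μ[Y | obsAlg V Y N t]) ω ^ 2 ∂μ := by
  have hm := h.obsAlg_le t
  have hY := h.memLp_input
  set E := μ[Y | obsAlg V Y N t] with hE
  have hELp : MemLp E 2 μ := memLp_condExp hY
  have h2 := h.condExp_out_side t (f := fun y => y ^ 2) (by fun_prop) hY.integrable_sq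
  set S := μ[fun ω => Y ω ^ 2 | obsAlg V Y N t] with hS
  have hZ : Measurable[obsAlg V Y N t] fun ω => t * Y ω + N ω :=
    measurable_fst.comp (comap_measurable fun ω => (t * Y ω + N ω, V ω))
  have hI1 : Integrable (fun ω => (t * Y ω + N ω) * E ω) μ := (h.memLp_out t).integrable_mul hELp
  have hI2 : Integrable (fun ω => E ω * Y ω) μ := hELp.integrable_mul hY
  have hIYN : Integrable (fun ω => Y ω * N ω) μ := hY.integrable_mul h.memLp_noise
  have hrep : (fun ω => pathScore (condDistrib Y V μ (V ω)) t (t * Y ω + N ω) (Y ω)) =ᵐ[μ]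
      fun ω => ((t * Y ω + N ω) * E ω + t * (E ω * Y ω)) - t * S ω := by
    filter_upwards [h.condExp_eq_postMean t, h2] with ω h1 h2
    rw [pathScore, hE, h1, h2]
    ring
  have hI3 : Integrable (fun ω => (t * Y ω + N ω) * E ω + t * (E ω * Y ω)) μ :=
    hI1.add (hI2.const_mul t)
  have hI4 : Integrable S μ := integrable_condExp
  rw [integral_congr_ae hrep, integral_sub hI3 (hI4.const_mul t), integral_add hI1 (hI2.const_mul t), integral_const_mul,
    integral_const_mul, integral_condExp_sq hm hY, hS, integral_condExp hm,
    integral_mul_condExp hm hY hZ.stronglyMeasurable (h.memLp_out t)]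
  have h3 : ∫ ω, (t * Y ω + N ω) * Y ω ∂μ = t * ∫ ω, Y ω ^ 2 ∂μ := by
    calc ∫ ω, (t * Y ω + N ω) * Y ω ∂μ = ∫ ω, (t * Y ω ^ 2 + Y ω * N ω) ∂μ := by
          congr 1; ext ω; ring
      _ = _ := by
          rw [integral_add (hY.integrable_sq.const_mul t) hIYN, integral_const_mul,
            h.integral_mul_noise, add_zero]
  rw [h3]
  ring

/-- Differentiation under the expectation sign, along the paths `t ↦ tY + N`. -/
lemma hasDerivAt_meanLogDens (h : GaussianInput μ V Y N) {t₀ : ℝ} (ht₀ : 0 < t₀) :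
    HasDerivAt (meanLogDens μ V Y N) (t₀ * ∫ ω, (μ[Y | obsAlg V Y N t₀]) ω ^ 2 ∂μ) t₀ := by
  rw [← h.integral_pathScore t₀]
  -- For `t` in `(a, b) = (t₀/2, 3t₀/2)` both `Z` and `Z + tY` are at most quadratic in `(Y, N)`, and
  -- the factor `1/t²` of the posterior second moment is at most `1/a²`.
  set a := t₀ / 2 with ha
  have ha0 : 0 < a := by positivity
  set b := 3 * a with hb
  have hY2 := h.memLp_input.integrable_sq
  have hN2 := h.memLp_noise.integrable_sq
  refine (hasDerivAt_integral_of_dominated_loc_of_deriv_le (μ := μ) (s := Metric.ball t₀ a)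
    (F' := fun t ω => pathScore (condDistrib Y V μ (V ω)) t (t * Y ω + N ω) (Y ω))
    (bound := fun ω => (8 * b ^ 2 * Y ω ^ 2 + 2 * N ω ^ 2) / 2 + (1 / 2 + b) *
      (6 * (2 * b ^ 2 * Y ω ^ 2 + 2 * N ω ^ 2) / a ^ 2 +
        4 * ∫ y, y ^ 2 ∂condDistrib Y V μ (V ω)))
    (Metric.ball_mem_nhds _ ha0)
    (Eventually.of_forall fun t => (h.measurable_outDens_out t).log.aestronglyMeasurable)
    (h.integrable_log_outDens t₀) ?_ ?_ ?_ ?_).2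
  · exact (((((h.measurable_out t₀).add (h.measurable_input.const_mul t₀)).mul
      (h.measurable_postMean_out t₀ measurable_id)).sub
      ((h.measurable_postMean_out t₀ (by fun_prop)).const_mul t₀))).aestronglyMeasurable
  · filter_upwards [h.ae_integrable_sq] with ω hω t ht
    rw [Metric.mem_ball, Real.dist_eq, abs_lt] at ht
    have hta : a ≤ t := by linarith [ht.1]
    have htb : t ≤ b := by linarith [ht.2]
    have ht0 : 0 < t := ha0.trans_le hta
    have ht2 : t ^ 2 ≤ b ^ 2 := by gcongr
    have hta2 : a ^ 2 ≤ t ^ 2 := by gcongr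
    have hY0 := sq_nonneg (Y ω)
    have hA0 : 0 ≤ ∫ y, y ^ 2 ∂condDistrib Y V μ (V ω) := integral_nonneg fun y => sq_nonneg y
    have hZ : (t * Y ω + N ω) ^ 2 ≤ 2 * b ^ 2 * Y ω ^ 2 + 2 * N ω ^ 2 := by
      nlinarith [sq_nonneg (t * Y ω - N ω)]
    have hZ' : (t * Y ω + N ω + t * Y ω) ^ 2 ≤ 8 * b ^ 2 * Y ω ^ 2 + 2 * N ω ^ 2 := by
      nlinarith [sq_nonneg (2 * t * Y ω - N ω)]
    have hs : postMean (condDistrib Y V μ (V ω)) t (t * Y ω + N ω) (fun x => x ^ 2) ≤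
        6 * (2 * b ^ 2 * Y ω ^ 2 + 2 * N ω ^ 2) / a ^ 2 +
          4 * ∫ y, y ^ 2 ∂condDistrib Y V μ (V ω) := by
      have h1 := sq_mul_postMean_sq_le hω t (t * Y ω + N ω)
      have h2 : postMean (condDistrib Y V μ (V ω)) t (t * Y ω + N ω) (fun x => x ^ 2) ≤
          6 * (t * Y ω + N ω) ^ 2 / t ^ 2 + 4 * ∫ y, y ^ 2 ∂condDistrib Y V μ (V ω) := by
        have ht2' : 0 < t ^ 2 := by positivity
        refine le_of_mul_le_mul_left (h1.trans_eq ?_) ht2'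
        field_simp
      refine h2.trans ?_
      gcongr
    refine (abs_pathScore_le hω ht0.le _ _).trans ?_
    have hs0 := postMean_sq_nonneg (condDistrib Y V μ (V ω)) t (t * Y ω + N ω)
    gcongr
  · exact ((((hY2.const_mul _).add (hN2.const_mul _)).div_const _).add
      ((((((hY2.const_mul _).add (hN2.const_mul _)).const_mul 6).div_const _).add
        (h.integrable_condSq.const_mul 4)).const_mul _))
  · filter_upwards [h.ae_integrable_sq] with ω hω t _
    exact hasDerivAt_log_outDens hω _ _ _

lemma continuousAt_meanLogDens_zero (h : GaussianInput μ V Y N) :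
    ContinuousAt (meanLogDens μ V Y N) 0 := by
  refine continuousAt_of_dominated
    (bound := fun ω => (2 * Y ω ^ 2 + 2 * N ω ^ 2) / 2 + ∫ y, y ^ 2 ∂condDistrib Y V μ (V ω))
    (Eventually.of_forall fun t => (h.measurable_outDens_out t).log.aestronglyMeasurable) ?_
    ((((h.memLp_input.integrable_sq.const_mul _).add
      (h.memLp_noise.integrable_sq.const_mul _)).div_const _).add h.integrable_condSq) ?_
  · filter_upwards [Metric.ball_mem_nhds (0 : ℝ) one_pos] with t ht
    filter_upwards [h.ae_integrable_sq] with ω hω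
    rw [Metric.mem_ball, Real.dist_eq, sub_zero] at ht
    have ht2 : t ^ 2 ≤ 1 := by
      rw [← sq_abs]; exact pow_le_one₀ (abs_nonneg t) ht.le
    have hY0 := sq_nonneg (Y ω)
    have hA0 : 0 ≤ ∫ y, y ^ 2 ∂condDistrib Y V μ (V ω) := integral_nonneg fun y => sq_nonneg y
    refine (abs_log_outDens_le hω _ _).trans ?_
    have hZ : (t * Y ω + N ω) ^ 2 ≤ 2 * Y ω ^ 2 + 2 * N ω ^ 2 := by
      nlinarith [sq_nonneg (t * Y ω - N ω)]
    have := mul_le_mul_of_nonneg_right ht2 hA0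
    linarith
  · filter_upwards [h.ae_integrable_sq] with ω hω
    exact (hasDerivAt_log_outDens hω (Y ω) (N ω) 0).continuousAt

lemma tendsto_postMean (h : GaussianInput μ V Y N) :
    ∀ᵐ ω ∂μ, Tendsto
      (fun t => postMean (condDistrib Y V μ (V ω)) t (t * Y ω + N ω) (fun y => y)) (𝓝 0)
      (𝓝 (postMean (condDistrib Y V μ (V ω)) 0 (0 * Y ω + N ω) (fun y => y))) := by
  filter_upwards [h.ae_integrable_sq] with ω hω
  set ν := condDistrib Y V μ (V ω)
  have h1 := integrable_of_sq hω
  have key : ∀ f : ℝ → ℝ, Integrable f ν →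
      ContinuousAt (fun t => ∫ y, f y * lik t (t * Y ω + N ω) y ∂ν) 0 := by
    intro f hf
    refine continuousAt_of_dominated
      (bound := fun y => ‖f y‖ * Real.exp ((|Y ω| + |N ω|) ^ 2 / 2))
      (Eventually.of_forall fun t => (integrable_mul_lik hf _ _).aestronglyMeasurable) ?_
      (hf.norm.mul_const _) (ae_of_all _ fun y => ?_)
    · filter_upwards [Metric.ball_mem_nhds (0 : ℝ) one_pos] with t ht
      refine ae_of_all _ fun y => ?_
      rw [Metric.mem_ball, Real.dist_eq, sub_zero] at ht
      rw [norm_mul, Real.norm_of_nonneg (lik_pos _ _ _).le]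
      refine mul_le_mul_of_nonneg_left ((lik_le _ _ _).trans ?_) (norm_nonneg _)
      have h2 : |t * Y ω + N ω| ≤ |Y ω| + |N ω| := by
        refine (abs_add_le _ _).trans ?_
        rw [abs_mul]
        have := mul_le_of_le_one_left (abs_nonneg (Y ω)) ht.le
        linarith
      have := sq_le_sq' (neg_le_of_abs_le h2) (le_of_abs_le h2)
      gcongr
    · unfold lik
      fun_prop
  have h2 : ContinuousAt (fun t => outDens ν t (t * Y ω + N ω)) 0 := by
    simpa [outDens] using key (fun _ => 1) (integrable_const _)
  exact (key _ h1).div h2 (outDens_pos _ _ _).ne'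

/-- Without a signal the observation is pure noise and does not help to estimate `Y`. -/
lemma condExp_zero (h : GaussianInput μ V Y N) :
    μ[Y | obsAlg V Y N 0] =ᵐ[μ] μ[Y | MeasurableSpace.comap V inferInstance] := by
  refine (h.condExp_eq_postMean 0).trans (EventuallyEq.trans ?_
    (condExp_ae_eq_integral_condDistrib' h.measurable_side
      (h.memLp_input.integrable one_le_two)).symm)
  exact ae_of_all _ fun ω => by simp [postMean, outDens, lik]

lemma integral_condExp_zero_le (h : GaussianInput μ V Y N) (t : ℝ) :
    ∫ ω, (μ[Y | obsAlg V Y N 0]) ω ^ 2 ∂μ ≤ ∫ ω, (μ[Y | obsAlg V Y N t]) ω ^ 2 ∂μ := by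
  have hV : MeasurableSpace.comap V inferInstance ≤ obsAlg V Y N t :=
    (measurable_snd.comp (comap_measurable fun ω => (t * Y ω + N ω, V ω))).comap_le
  have h1 := integral_condExp_sub_sq hV (h.obsAlg_le t) h.memLp_input
  have h2 : ∫ ω, (μ[Y | obsAlg V Y N 0]) ω ^ 2 ∂μ =
      ∫ ω, (μ[Y | MeasurableSpace.comap V inferInstance]) ω ^ 2 ∂μ := by
    refine integral_congr_ae ?_
    filter_upwards [h.condExp_zero] with ω hω
    rw [hω]
  rw [h2, ← sub_nonneg, ← h1]
  exact integral_nonneg fun ω => sq_nonneg _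

/-- As the signal vanishes, the second moment of the posterior mean tends to its value without
the signal. The mean square error is upper semicontinuous because `E[Y|V]` is always a possible
estimator, and lower semicontinuous by Fatou's lemma. -/
lemma tendsto_integral_condExp_sq (h : GaussianInput μ V Y N) :
    Tendsto (fun t => ∫ ω, (μ[Y | obsAlg V Y N t]) ω ^ 2 ∂μ) (𝓝 0)
      (𝓝 (∫ ω, (μ[Y | obsAlg V Y N 0]) ω ^ 2 ∂μ)) := by
  refine tendsto_order.2 ⟨fun c hc => Eventually.of_forall fun t =>
    hc.trans_le (h.integral_condExp_zero_le t), fun c hc => ?_⟩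
  set P : ℝ → Ω → ℝ := fun t ω =>
    postMean (condDistrib Y V μ (V ω)) t (t * Y ω + N ω) (fun y => y) with hP
  have hlin : ∀ t, ∫⁻ ω, ENNReal.ofReal ((Y ω - P t ω) ^ 2) ∂μ =
      ENNReal.ofReal (∫ ω, Y ω ^ 2 ∂μ - ∫ ω, (μ[Y | obsAlg V Y N t]) ω ^ 2 ∂μ) := by
    intro t
    have hsq : Integrable (fun ω => (Y ω - (μ[Y | obsAlg V Y N t]) ω) ^ 2) μ :=
      (h.memLp_input.sub (memLp_condExp h.memLp_input)).integrable_sq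
    rw [← integral_sub_condExp_sq (h.obsAlg_le t) h.memLp_input,
      ofReal_integral_eq_lintegral_ofReal hsq (ae_of_all _ fun ω => sq_nonneg _)]
    refine lintegral_congr_ae ?_
    filter_upwards [h.condExp_eq_postMean t] with ω hω
    rw [hω]
  have hmeas : ∀ t, Measurable (fun ω => ENNReal.ofReal ((Y ω - P t ω) ^ 2)) := fun t =>
    ((h.measurable_input.sub (h.measurable_postMean_out t measurable_id)).pow_const 2).ennreal_ofReal
  have hfatou := lintegral_liminf_le (μ := μ) (u := 𝓝 (0 : ℝ)) hmeas
  have hlim : ∀ᵐ ω ∂μ, liminf (fun t => ENNReal.ofReal ((Y ω - P t ω) ^ 2)) (𝓝 0) =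
      ENNReal.ofReal ((Y ω - P 0 ω) ^ 2) := by
    filter_upwards [h.tendsto_postMean] with ω hω
    exact (ENNReal.tendsto_ofReal ((tendsto_const_nhds.sub hω).pow 2)).liminf_eq
  rw [lintegral_congr_ae hlim] at hfatou
  simp_rw [hlin] at hfatou
  have hnn : 0 ≤ ∫ ω, Y ω ^ 2 ∂μ - ∫ ω, (μ[Y | obsAlg V Y N 0]) ω ^ 2 ∂μ := by
    rw [← integral_sub_condExp_sq (h.obsAlg_le 0) h.memLp_input]
    exact integral_nonneg fun ω => sq_nonneg _
  by_cases hcY : 0 ≤ ∫ ω, Y ω ^ 2 ∂μ - c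
  · have hlt : ENNReal.ofReal (∫ ω, Y ω ^ 2 ∂μ - c) < ENNReal.ofReal
        (∫ ω, Y ω ^ 2 ∂μ - ∫ ω, (μ[Y | obsAlg V Y N 0]) ω ^ 2 ∂μ) :=
      (ENNReal.ofReal_lt_ofReal_iff (by linarith)).2 (by linarith)
    filter_upwards [eventually_lt_of_lt_liminf (hlt.trans_le hfatou)] with t ht
    have := lt_of_not_ge fun hle => absurd (ENNReal.ofReal_le_ofReal hle) (not_le.2 ht)
    linarith
  · refine Eventually.of_forall fun t => ?_
    have : 0 ≤ ∫ ω, Y ω ^ 2 ∂μ - ∫ ω, (μ[Y | obsAlg V Y N t]) ω ^ 2 ∂μ := by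
      rw [← integral_sub_condExp_sq (h.obsAlg_le t) h.memLp_input]
      exact integral_nonneg fun ω => sq_nonneg _
    linarith

/-- The derivative of the mean log-likelihood ratio in the signal-to-noise ratio is half of the
second moment of the posterior mean. -/
lemma hasDerivWithinAt_meanLogDens_sqrt (h : GaussianInput μ V Y N) {γ : ℝ} (hγ : 0 ≤ γ) :
    HasDerivWithinAt (fun γ => meanLogDens μ V Y N (√γ))
      ((∫ ω, (μ[Y | obsAlg V Y N (√γ)]) ω ^ 2 ∂μ) / 2) (Set.Ici 0) γ := by
  have hpos : ∀ γ : ℝ, 0 < γ → HasDerivAt (fun γ => meanLogDens μ V Y N (√γ))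
      ((∫ ω, (μ[Y | obsAlg V Y N (√γ)]) ω ^ 2 ∂μ) / 2) γ := by
    intro γ hγ
    have hs := Real.sqrt_pos.2 hγ
    have := (h.hasDerivAt_meanLogDens hs).comp γ (Real.hasDerivAt_sqrt hγ.ne')
    convert! this using 1
    field_simp
  rcases hγ.eq_or_lt with rfl | hγ
  · refine hasDerivWithinAt_Ici_of_tendsto_deriv (s := Set.Ioi 0)
      (fun γ hγ => (hpos γ hγ).differentiableAt.differentiableWithinAt) ?_ self_mem_nhdsWithin ?_
    · have h1 : ContinuousAt (meanLogDens μ V Y N) (√0) := by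
        rw [Real.sqrt_zero]; exact h.continuousAt_meanLogDens_zero
      exact (h1.comp Real.continuous_sqrt.continuousAt).continuousWithinAt
    · have h1 : Tendsto (fun γ : ℝ => √γ) (𝓝[>] 0) (𝓝 0) := by
        have := Real.continuous_sqrt.tendsto 0
        rw [Real.sqrt_zero] at this
        exact this.mono_left nhdsWithin_le_nhds
      have h2 := (h.tendsto_integral_condExp_sq.comp h1).div_const 2
      rw [Real.sqrt_zero]
      refine h2.congr' ?_
      filter_upwards [self_mem_nhdsWithin] with γ hγ
      exact ((hpos γ hγ).deriv).symm
  · exact (hpos γ hγ).hasDerivWithinAt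

end GaussianInput

/-! ### Mutual information as a difference of mean log-likelihood ratios -/

lemma klDiv_withDensity_withDensity {α : Type*} [MeasurableSpace α] (T : Measure α) [SigmaFinite T]
    {f g : α → ℝ} (hf : Measurable f) (hg : Measurable g) (hg0 : ∀ x, 0 < g x)
    (hf0 : ∀ x, 0 < f x) {P Q : Measure α} [IsProbabilityMeasure P] [IsProbabilityMeasure Q]
    (hP : P = T.withDensity fun x => ENNReal.ofReal (f x))
    (hQ : Q = T.withDensity fun x => ENNReal.ofReal (g x))
    (hfi : Integrable (fun x => Real.log (f x)) P) (hgi : Integrable (fun x => Real.log (g x)) P) :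
    InformationTheory.klDiv P Q =
        ENNReal.ofReal (∫ x, Real.log (f x) ∂P - ∫ x, Real.log (g x) ∂P) ∧
      0 ≤ ∫ x, Real.log (f x) ∂P - ∫ x, Real.log (g x) ∂P := by
  have hPT : P ≪ T := hP ▸ withDensity_absolutelyContinuous _ _
  have hTQ : T ≪ Q := by
    rw [hQ]
    exact withDensity_absolutelyContinuous' hg.ennreal_ofReal.aemeasurable
      (ae_of_all _ fun x => by simpa using hg0 x)
  have hPQ : P ≪ Q := hPT.trans hTQ
  have h1 : P.rnDeriv T =ᵐ[T] fun x => ENNReal.ofReal (f x) := by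
    rw [hP]; exact Measure.rnDeriv_withDensity T hf.ennreal_ofReal
  have h2 : P.rnDeriv Q =ᵐ[T] fun x => (ENNReal.ofReal (g x))⁻¹ * P.rnDeriv T x := by
    rw [hQ]
    exact Measure.rnDeriv_withDensity_right P T hg.ennreal_ofReal.aemeasurable
      (ae_of_all _ fun x => by simpa using hg0 x) (by simp)
  have hllr : llr P Q =ᵐ[P] fun x => Real.log (f x) - Real.log (g x) := by
    filter_upwards [hPT h1, hPT h2] with x hx1 hx2
    rw [llr, hx2, hx1, ENNReal.toReal_mul, ENNReal.toReal_inv, ENNReal.toReal_ofReal (hg0 x).le,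
      ENNReal.toReal_ofReal (hf0 x).le, Real.log_mul (inv_pos.2 (hg0 x)).ne' (hf0 x).ne',
      Real.log_inv]
    ring
  have hint : Integrable (llr P Q) P := (integrable_congr hllr).2 (hfi.sub hgi)
  have heq : ∫ x, llr P Q x ∂P = ∫ x, Real.log (f x) ∂P - ∫ x, Real.log (g x) ∂P := by
    rw [integral_congr_ae hllr, integral_sub hfi hgi]
  constructor
  · rw [InformationTheory.klDiv_of_ac_of_integrable hPQ hint, heq]
    simp
  · rw [← heq, ← InformationTheory.toReal_klDiv_of_measure_eq hPQ (by simp)]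
    exact ENNReal.toReal_nonneg

lemma condDistrib_const_side {Ω : Type*} [MeasurableSpace Ω] {μ : Measure Ω}
    [IsProbabilityMeasure μ] {Y : Ω → ℝ} (hY : Measurable Y) (c : ℝ) :
    condDistrib Y (fun _ => c) μ c = μ.map Y := by
  have := Measure.isProbabilityMeasure_map (μ := μ) hY.aemeasurable
  have hdirac : μ.map (fun _ : Ω => c) = Measure.dirac c := by simp [Measure.map_const]
  have h := condDistrib_ae_eq_of_measure_eq_compProd (μ := μ) (fun _ : Ω => c) hY.aemeasurable
    (κ := Kernel.const ℝ (μ.map Y)) (by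
      rw [Measure.compProd_const]
      exact (indepFun_iff_map_prod_eq_prod_map_map aemeasurable_const hY.aemeasurable).1
        (indepFun_const_left c Y))
  rw [hdirac] at h
  have h2 := (ae_dirac_eq c ▸ h : ∀ᶠ x in pure c, _)
  simpa using h2

namespace GaussianInput

variable {Ω : Type*} [MeasurableSpace Ω] {μ : Measure Ω} {V Y N : Ω → ℝ}

lemma const_side (h : GaussianInput μ V Y N) (c : ℝ) : GaussianInput μ (fun _ => c) Y N :=
  { h with
    measurable_side := measurable_const
    indep := h.indep.comp (φ := fun p : ℝ × ℝ => (c, p.2)) (by fun_prop) measurable_id }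

lemma self_side (h : GaussianInput μ V Y N) : GaussianInput μ Y Y N :=
  { h with
    measurable_side := h.measurable_input
    indep := h.indep.comp (φ := fun p : ℝ × ℝ => (p.2, p.2)) (by fun_prop) measurable_id }

variable [IsProbabilityMeasure μ]

lemma map_side_out (h : GaussianInput μ V Y N) (t : ℝ) :
    μ.map (fun ω => (V ω, t * Y ω + N ω)) =
      ((μ.map V).prod (gaussianReal 0 1)).withDensity
        fun p => ENNReal.ofReal (outDens (condDistrib Y V μ p.1) t p.2) := by
  have hm := (measurable_outDens_pair (condDistrib Y V μ) t).ennreal_ofReal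
  have hm2 : Measurable fun p : ℝ × ℝ => ENNReal.ofReal (outDens (condDistrib Y V μ p.1) t p.2) :=
    hm.comp measurable_swap
  refine Measure.ext_of_lintegral _ fun g hg => ?_
  have h1 : ∫⁻ ω, g (V ω, t * Y ω + N ω) ∂μ =
      ∫⁻ p, g p.swap ∂(μ.map fun ω => (t * Y ω + N ω, V ω)) := by
    rw [lintegral_map (by fun_prop) ((h.measurable_out t).prodMk h.measurable_side)]
    rfl
  rw [lintegral_map hg (h.measurable_side.prodMk (h.measurable_out t)), h1, h.map_out_side t,
    lintegral_withDensity_eq_lintegral_mul _ hm (by fun_prop),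
    lintegral_withDensity_eq_lintegral_mul _ hm2 hg, ← lintegral_prod_swap]
  rfl

lemma map_out (h : GaussianInput μ V Y N) (t : ℝ) :
    μ.map (fun ω => t * Y ω + N ω) =
      (gaussianReal 0 1).withDensity fun z => ENNReal.ofReal (outDens (μ.map Y) t z) := by
  have h0 := h.const_side 0
  have hm := (measurable_outDens_pair (condDistrib Y (fun _ => (0 : ℝ)) μ) t).ennreal_ofReal
  refine Measure.ext_of_lintegral _ fun g hg => ?_
  have h1 : ∫⁻ ω, g (t * Y ω + N ω) ∂μ =
      ∫⁻ p, g p.1 ∂(μ.map fun ω => (t * Y ω + N ω, (0 : ℝ))) := by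
    rw [lintegral_map (by fun_prop) ((h.measurable_out t).prodMk measurable_const)]
  have hdirac : μ.map (fun _ : Ω => (0 : ℝ)) = Measure.dirac 0 := by simp [Measure.map_const]
  rw [lintegral_map hg (h.measurable_out t), h1, h0.map_out_side t,
    lintegral_withDensity_eq_lintegral_mul _ hm (by fun_prop), hdirac,
    lintegral_prod _ (hm.mul (by fun_prop)).aemeasurable]
  have hm' : Measurable fun z => ENNReal.ofReal (outDens (μ.map Y) t z) := by
    rw [← condDistrib_const_side h.measurable_input 0]
    exact hm.comp (measurable_id.prodMk measurable_const)
  rw [lintegral_withDensity_eq_lintegral_mul _ hm' hg]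
  refine lintegral_congr fun z => ?_
  rw [lintegral_dirac]
  simp only [Pi.mul_apply, condDistrib_const_side h.measurable_input]

lemma meanLogDens_const (h : GaussianInput μ V Y N) (c t : ℝ) :
    meanLogDens μ (fun _ => c) Y N t =
      ∫ ω, Real.log (outDens (μ.map Y) t (t * Y ω + N ω)) ∂μ := by
  rw [meanLogDens, condDistrib_const_side h.measurable_input]

/-- `I(V; Z) = E[log L(Z | V)] - E[log L(Z)]`, in particular it is finite. -/
lemma mutualInfo_eq (h : GaussianInput μ V Y N) {b : ℝ} (hb : 1 < b) (t : ℝ) :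
    mutualInfo b V (fun ω => t * Y ω + N ω) μ =
        ENNReal.ofReal
          ((meanLogDens μ V Y N t - meanLogDens μ (fun _ => 0) Y N t) / Real.log b) ∧
      0 ≤ meanLogDens μ V Y N t - meanLogDens μ (fun _ => 0) Y N t := by
  have hVZ := h.measurable_side.prodMk (h.measurable_out t)
  have hV := Measure.isProbabilityMeasure_map (μ := μ) h.measurable_side.aemeasurable
  have hYp := Measure.isProbabilityMeasure_map (μ := μ) h.measurable_input.aemeasurable
  have hZ := Measure.isProbabilityMeasure_map (μ := μ) (h.measurable_out t).aemeasurable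
  have hVZp := Measure.isProbabilityMeasure_map (μ := μ) hVZ.aemeasurable
  have hm := (measurable_outDens_pair (condDistrib Y V μ) t).comp measurable_swap
  have hm0 : Measurable fun z => outDens (μ.map Y) t z := by
    rw [← condDistrib_const_side h.measurable_input 0]
    exact (measurable_outDens_pair (condDistrib Y (fun _ => (0 : ℝ)) μ) t).comp
      (measurable_id.prodMk measurable_const)
  have hQ : (μ.map V).prod (μ.map fun ω => t * Y ω + N ω) =
      ((μ.map V).prod (gaussianReal 0 1)).withDensity
        fun p => ENNReal.ofReal (outDens (μ.map Y) t p.2) := by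
    rw [h.map_out t, prod_withDensity_right hm0.ennreal_ofReal]
  have hi1 := h.integrable_log_outDens t
  have hi2 := (h.const_side 0).integrable_log_outDens t
  simp only [condDistrib_const_side h.measurable_input] at hi2
  have hl1 : Measurable fun p : ℝ × ℝ => Real.log (outDens (condDistrib Y V μ p.1) t p.2) :=
    hm.log
  have hl2 : Measurable fun p : ℝ × ℝ => Real.log (outDens (μ.map Y) t p.2) :=
    (hm0.comp measurable_snd).log
  have hkl := klDiv_withDensity_withDensity _ hm (hm0.comp measurable_snd)
    (fun p => outDens_pos _ _ _) (fun p => outDens_pos _ _ _) (h.map_side_out t) hQ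
    ((integrable_map_measure hl1.aestronglyMeasurable hVZ.aemeasurable).2 hi1)
    ((integrable_map_measure hl2.aestronglyMeasurable hVZ.aemeasurable).2 hi2)
  simp only [Function.comp_def, Prod.fst_swap, Prod.snd_swap] at hkl
  rw [integral_map hVZ.aemeasurable hl1.aestronglyMeasurable,
    integral_map hVZ.aemeasurable hl2.aestronglyMeasurable] at hkl
  rw [h.meanLogDens_const, mutualInfo, hkl.1, ENNReal.ofReal_div_of_pos (Real.log_pos hb)]
  exact ⟨rfl, hkl.2⟩

end GaussianInput

/-! ### Variational formula and lower semicontinuity of the divergence -/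

section

variable {α : Type*} [MeasurableSpace α] {P Q : Measure α} [IsProbabilityMeasure P]
  [IsProbabilityMeasure Q]

lemma integrable_of_abs_le {R : Measure α} [IsFiniteMeasure R] {f : α → ℝ} (hf : Measurable f)
    {C : ℝ} (hC : ∀ x, |f x| ≤ C) : Integrable f R :=
  Integrable.of_bound hf.aestronglyMeasurable C (ae_of_all _ hC)

lemma integrable_exp_of_abs_le {R : Measure α} [IsFiniteMeasure R] {f : α → ℝ} (hf : Measurable f)
    {C : ℝ} (hC : ∀ x, |f x| ≤ C) : Integrable (fun x => Real.exp (f x) - 1) R := by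
  refine Integrable.sub ?_ (integrable_const _)
  refine Integrable.of_bound hf.exp.aestronglyMeasurable (Real.exp C) (ae_of_all _ fun x => ?_)
  rw [Real.norm_of_nonneg (Real.exp_pos _).le]
  exact Real.exp_le_exp.2 (le_of_abs_le (hC x))

/-- The easy half of the variational formula for the divergence. -/
lemma ofReal_integral_sub_le_klDiv {f : α → ℝ} (hf : Measurable f) {C : ℝ}
    (hC : ∀ x, |f x| ≤ C) :
    ENNReal.ofReal (∫ x, f x ∂P - ∫ x, (Real.exp (f x) - 1) ∂Q) ≤
      InformationTheory.klDiv P Q := by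
  by_cases htop : InformationTheory.klDiv P Q = ∞
  · rw [htop]; exact le_top
  obtain ⟨hPQ, hint⟩ := InformationTheory.klDiv_ne_top_iff.1 htop
  rw [InformationTheory.klDiv_eq_integral_klFun, if_pos ⟨hPQ, hint⟩]
  refine ENNReal.ofReal_le_ofReal ?_
  rw [← integral_rnDeriv_smul hPQ (f := f)]
  have h1 : Integrable (fun x => (P.rnDeriv Q x).toReal • f x) Q :=
    (integrable_rnDeriv_smul_iff hPQ).2 (integrable_of_abs_le hf hC)
  rw [← integral_sub h1 (integrable_exp_of_abs_le hf hC)]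
  refine integral_mono (h1.sub (integrable_exp_of_abs_le hf hC))
    ((InformationTheory.integrable_klFun_rnDeriv_iff hPQ).2 hint) fun x => ?_
  have hr : 0 ≤ (P.rnDeriv Q x).toReal := ENNReal.toReal_nonneg
  generalize (P.rnDeriv Q x).toReal = r at hr
  simp only [smul_eq_mul, InformationTheory.klFun]
  rcases hr.eq_or_lt with rfl | hr
  · simp [(Real.exp_pos (f x)).le]
  · have h2 := Real.add_one_le_exp (f x - Real.log r)
    rw [Real.exp_sub, Real.exp_log hr, le_div_iff₀ hr] at h2
    linarith

/-- Every number below the divergence is below the variational functional of some bounded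
measurable function, a truncation of the log-likelihood ratio. -/
lemma exists_lt_integral_sub_of_lt_klDiv {c : ℝ}
    (hc : ENNReal.ofReal c < InformationTheory.klDiv P Q) :
    ∃ (f : α → ℝ) (C : ℝ), Measurable f ∧ (∀ x, |f x| ≤ C) ∧
      c < ∫ x, f x ∂P - ∫ x, (Real.exp (f x) - 1) ∂Q := by
  by_cases hPQ : P ≪ Q
  · -- The test functions are `log k n`, with `k n` the density clamped to `[exp (-n), exp n]`; clamping
    -- before taking the logarithm gives the value `-n`, not `log 0 = 0`, where the density vanishes.
    set r : α → ℝ := fun x => (P.rnDeriv Q x).toReal with hr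
    have hrm : Measurable r := (Measure.measurable_rnDeriv P Q).ennreal_toReal
    have hr0 : ∀ x, 0 ≤ r x := fun x => ENNReal.toReal_nonneg
    set k : ℕ → α → ℝ := fun n x => max (Real.exp (-n)) (min (r x) (Real.exp n)) with hk
    have hkm : ∀ n, Measurable (k n) := fun n => measurable_const.max (hrm.min measurable_const)
    have hk0 : ∀ n x, 0 < k n x := fun n x => lt_max_of_lt_left (Real.exp_pos _)
    have hkn : ∀ (n : ℕ) x, k n x ≤ Real.exp n := fun n x =>
      max_le (Real.exp_le_exp.2 (by have : (0 : ℝ) ≤ n := n.cast_nonneg; linarith))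
        (min_le_right _ _)
    have hb : ∀ (n : ℕ) x, |Real.log (k n x)| ≤ n := by
      intro n x
      refine abs_le.2 ⟨?_, ?_⟩
      · rw [Real.le_log_iff_exp_le (hk0 n x)]; exact le_max_left _ _
      · rw [Real.log_le_iff_le_exp (hk0 n x)]; exact hkn n x
    set φ : ℕ → α → ℝ := fun n x => r x * Real.log (k n x) - (k n x - 1) with hφ
    have hφm : ∀ n, Measurable (φ n) := fun n =>
      (hrm.mul (hkm n).log).sub ((hkm n).sub_const 1)
    have hφ0 : ∀ n x, 0 ≤ φ n x := by
      intro n x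
      have h1 := InformationTheory.klFun_nonneg (hk0 n x).le
      rw [InformationTheory.klFun] at h1
      have hn : (0 : ℝ) ≤ n := n.cast_nonneg
      have h2 : k n x * Real.log (k n x) ≤ r x * Real.log (k n x) := by
        rcases le_total (r x) (Real.exp n) with h3 | h3
        · rcases le_total (r x) (Real.exp (-n)) with h4 | h4
          · have h5 : k n x = Real.exp (-n) := by
              simp only [hk]; rw [min_eq_left h3, max_eq_left h4]
            rw [h5, Real.log_exp]
            nlinarith
          · have h5 : k n x = r x := by
              simp only [hk]; rw [min_eq_left h3, max_eq_right h4]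
            rw [h5]
        · have h5 : k n x = Real.exp n := by
            simp only [hk]
            rw [min_eq_right h3, max_eq_right (Real.exp_le_exp.2 (by linarith))]
          rw [h5, Real.log_exp]
          nlinarith
      simp only [hφ]
      linarith
    have hlim : ∀ x, Tendsto (fun n => φ n x) atTop (𝓝 (InformationTheory.klFun (r x))) := by
      intro x
      have hexp : Tendsto (fun n : ℕ => Real.exp (-(n : ℝ))) atTop (𝓝 0) :=
        Real.tendsto_exp_neg_atTop_nhds_zero.comp tendsto_natCast_atTop_atTop
      rcases (hr0 x).eq_or_lt with h0 | h0
      · have h1 : ∀ n, φ n x = 1 - Real.exp (-(n : ℝ)) := by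
          intro n
          simp only [hφ, hk]
          rw [← h0, min_eq_left (Real.exp_pos _).le, max_eq_left (Real.exp_pos _).le]
          ring
        simp_rw [h1, ← h0]
        simpa [InformationTheory.klFun_zero] using hexp.const_sub 1
      · have h1 : ∀ᶠ n : ℕ in atTop, φ n x = InformationTheory.klFun (r x) := by
          have h2 : ∀ᶠ n : ℕ in atTop, r x < Real.exp n :=
            (Real.tendsto_exp_atTop.comp tendsto_natCast_atTop_atTop).eventually_gt_atTop (r x)
          filter_upwards [h2, hexp.eventually_lt_const h0] with n h2 h3
          simp only [hφ, hk]
          rw [min_eq_left h2.le, max_eq_right h3.le, InformationTheory.klFun]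
          ring
        exact tendsto_const_nhds.congr' (h1.mono fun n hn => hn.symm)
    have hfatou := lintegral_liminf_le (μ := Q) (u := atTop)
      (f := fun n x => ENNReal.ofReal (φ n x)) fun n => (hφm n).ennreal_ofReal
    have hl : ∀ x, liminf (fun n => ENNReal.ofReal (φ n x)) atTop =
        ENNReal.ofReal (InformationTheory.klFun (r x)) := fun x =>
      (ENNReal.tendsto_ofReal (hlim x)).liminf_eq
    simp_rw [hl] at hfatou
    rw [InformationTheory.klDiv_eq_lintegral_klFun_of_ac hPQ] at hc
    obtain ⟨n, hn⟩ := (eventually_lt_of_lt_liminf (hc.trans_le hfatou)).exists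
    have hf : Measurable fun x => Real.log (k n x) := (hkm n).log
    have hi1 : Integrable (fun x => r x • Real.log (k n x)) Q :=
      (integrable_rnDeriv_smul_iff hPQ).2 (integrable_of_abs_le hf (hb n))
    have hi2 := integrable_exp_of_abs_le (R := Q) hf (hb n)
    have hφe : φ n = fun x => r x • Real.log (k n x) - (Real.exp (Real.log (k n x)) - 1) := by
      ext x; simp only [hφ, smul_eq_mul, Real.exp_log (hk0 n x)]
    have hφi : Integrable (φ n) Q := by rw [hφe]; exact hi1.sub hi2
    refine ⟨fun x => Real.log (k n x), n, hf, hb n, ?_⟩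
    rw [← ofReal_integral_eq_lintegral_ofReal hφi (ae_of_all _ (hφ0 n))] at hn
    have h3 : c < ∫ x, φ n x ∂Q := lt_of_not_ge fun hle =>
      absurd (ENNReal.ofReal_le_ofReal hle) (not_le.2 hn)
    rwa [hφe, integral_sub hi1 hi2, integral_rnDeriv_smul hPQ] at h3
  · -- A large multiple of the indicator of a `Q`-null set that is not `P`-null.
    obtain ⟨s, hs, hQs, hPs⟩ : ∃ s, MeasurableSet s ∧ Q s = 0 ∧ P s ≠ 0 := by
      by_contra! hcon
      exact hPQ (Measure.AbsolutelyContinuous.mk hcon)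
    have hPs' : 0 < P.real s := ENNReal.toReal_pos hPs (measure_ne_top _ _)
    obtain ⟨n, hn⟩ := exists_nat_gt (c / P.real s)
    refine ⟨s.indicator fun _ => (n : ℝ), n, measurable_const.indicator hs, fun x => ?_, ?_⟩
    · by_cases hx : x ∈ s <;> simp [hx]
    · have h1 : ∀ᵐ x ∂Q, Real.exp (s.indicator (fun _ => (n : ℝ)) x) - 1 = 0 := by
        filter_upwards [measure_eq_zero_iff_ae_notMem.1 hQs] with x hx
        simp [hx]
      rw [integral_congr_ae h1, integral_indicator_const _ hs]
      rw [div_lt_iff₀ hPs'] at hn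
      simpa [mul_comm] using hn

/-- The bounded test function can be chosen continuous. -/
lemma exists_continuous_lt_integral_sub_of_lt_klDiv [TopologicalSpace α] [NormalSpace α]
    [BorelSpace α] {c : ℝ} [(P + Q).WeaklyRegular]
    (hc : ENNReal.ofReal c < InformationTheory.klDiv P Q) :
    ∃ (g : α → ℝ) (C : ℝ), Continuous g ∧ (∀ x, |g x| ≤ C) ∧
      c < ∫ x, g x ∂P - ∫ x, (Real.exp (g x) - 1) ∂Q := by
  obtain ⟨f, C, hf, hC, hcf⟩ := exists_lt_integral_sub_of_lt_klDiv hc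
  set d := ∫ x, f x ∂P - ∫ x, (Real.exp (f x) - 1) ∂Q with hd
  have hδ : 0 < (d - c) / (2 * (1 + Real.exp C)) := by
    have := Real.exp_pos C
    have : 0 < d - c := by linarith
    positivity
  obtain ⟨g, hg, hgi⟩ :=
    (integrable_of_abs_le (R := P + Q) hf hC).exists_boundedContinuous_integral_sub_le hδ
  have hC0 : 0 ≤ C := by
    obtain ⟨x⟩ := P.nonempty_of_neZero
    exact (abs_nonneg _).trans (hC x)
  set k : α → ℝ := fun x => max (-C) (min (g x) C) with hk
  have hkc : Continuous k := continuous_const.max (g.continuous.min continuous_const)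
  have hkC : ∀ x, |k x| ≤ C := fun x =>
    abs_le.2 ⟨le_max_left _ _, max_le (by linarith) (min_le_right _ _)⟩
  have hclose : ∀ x, |f x - k x| ≤ ‖f x - g x‖ := by
    intro x
    have h1 := abs_le.1 (hC x)
    have h2 := le_abs_self (f x - g x)
    have h3 := neg_abs_le (f x - g x)
    rw [Real.norm_eq_abs]
    simp only [hk]
    rcases le_total (g x) C with h4 | h4
    · rw [min_eq_left h4]
      rcases le_total (-C) (g x) with h5 | h5
      · rw [max_eq_right h5]
      · rw [max_eq_left h5]
        exact abs_le.2 ⟨by linarith, by linarith⟩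
    · rw [min_eq_right h4, max_eq_right (by linarith)]
      exact abs_le.2 ⟨by linarith, by linarith⟩
  have hexp : ∀ x, Real.exp (k x) - Real.exp (f x) ≤ Real.exp C * ‖f x - g x‖ := by
    intro x
    have h1 := Real.add_one_le_exp (f x - k x)
    have h2 : Real.exp (f x) = Real.exp (k x) * Real.exp (f x - k x) := by
      rw [← Real.exp_add]; congr 1; ring
    have h3 : Real.exp (k x) ≤ Real.exp C := Real.exp_le_exp.2 (le_of_abs_le (hkC x))
    calc Real.exp (k x) - Real.exp (f x) ≤ Real.exp (k x) * |f x - k x| := by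
          have := mul_le_mul_of_nonneg_left h1 (Real.exp_pos (k x)).le
          have := mul_le_mul_of_nonneg_left (neg_abs_le (f x - k x)) (Real.exp_pos (k x)).le
          rw [h2]; linarith
      _ ≤ Real.exp C * ‖f x - g x‖ := by
          gcongr
          exact hclose x
  have hdiff : Integrable (fun x => ‖f x - g x‖) (P + Q) :=
    ((integrable_of_abs_le hf hC).sub hgi).norm
  have hdP := hdiff.left_of_add_measure
  have hdQ := hdiff.right_of_add_measure
  rw [integral_add_measure hdP hdQ] at hg
  have hP1 : ∫ x, f x ∂P - ∫ x, k x ∂P ≤ ∫ x, ‖f x - g x‖ ∂P := by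
    rw [← integral_sub (integrable_of_abs_le hf hC) (integrable_of_abs_le hkc.measurable hkC)]
    exact integral_mono ((integrable_of_abs_le hf hC).sub
      (integrable_of_abs_le hkc.measurable hkC)) hdP
      fun x => (le_abs_self _).trans (hclose x)
  have hQ1 : ∫ x, (Real.exp (k x) - 1) ∂Q - ∫ x, (Real.exp (f x) - 1) ∂Q ≤
      Real.exp C * ∫ x, ‖f x - g x‖ ∂Q := by
    rw [← integral_sub (integrable_exp_of_abs_le hkc.measurable hkC)
      (integrable_exp_of_abs_le hf hC), ← integral_const_mul]
    refine integral_mono ((integrable_exp_of_abs_le hkc.measurable hkC).sub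
      (integrable_exp_of_abs_le hf hC)) (hdQ.const_mul _) fun x => ?_
    have := hexp x
    dsimp only
    linarith
  refine ⟨k, C, hkc, hkC, ?_⟩
  have hP0 : 0 ≤ ∫ x, ‖f x - g x‖ ∂P := integral_nonneg fun x => norm_nonneg _
  have hQ0 : 0 ≤ ∫ x, ‖f x - g x‖ ∂Q := integral_nonneg fun x => norm_nonneg _
  have hE := Real.exp_pos C
  rw [le_div_iff₀ (by positivity)] at hg
  nlinarith

end

/-- The observation determines the input in the limit of a strong signal: the divergence is lower
semicontinuous along the rescaled observations `Y + N / t`. -/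
lemma exists_lt_klDiv_out {Ω : Type*} [MeasurableSpace Ω] {μ : Measure Ω} [IsProbabilityMeasure μ]
    {X Y N : Ω → ℝ} (hX : Measurable X) (hY : Measurable Y) (hN : Measurable N) {c : ℝ}
    (hc : ENNReal.ofReal c <
      InformationTheory.klDiv (μ.map fun ω => (X ω, Y ω)) ((μ.map X).prod (μ.map Y))) (hc0 : 0 ≤ c) :
    ∃ t : ℝ, 0 < t ∧ ENNReal.ofReal c <
      InformationTheory.klDiv (μ.map fun ω => (X ω, t * Y ω + N ω))
        ((μ.map X).prod (μ.map fun ω => t * Y ω + N ω)) := by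
  have hXp := Measure.isProbabilityMeasure_map (μ := μ) hX.aemeasurable
  have hYp := Measure.isProbabilityMeasure_map (μ := μ) hY.aemeasurable
  have hXYp := Measure.isProbabilityMeasure_map (μ := μ) (hX.prodMk hY).aemeasurable
  obtain ⟨g, C, hg, hC, hcg⟩ := exists_continuous_lt_integral_sub_of_lt_klDiv hc
  have hZ : ∀ t : ℝ, Measurable fun ω => t * Y ω + N ω := fun t => (hY.const_mul t).add hN
  set T : ℕ → ℝ := fun n => n + 1 with hT
  have hTpos : ∀ n, 0 < T n := fun n => by positivity
  have hTlim : Tendsto T atTop atTop :=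
    tendsto_atTop_add_const_right _ _ tendsto_natCast_atTop_atTop
  have hpt : ∀ ω, Tendsto (fun n => (T n * Y ω + N ω) / T n) atTop (𝓝 (Y ω)) := by
    intro ω
    have h1 : ∀ n, (T n * Y ω + N ω) / T n = Y ω + N ω / T n := fun n => by
      have := (hTpos n).ne'
      field_simp
    simp_rw [h1]
    simpa using (tendsto_const_nhds (x := N ω)).div_atTop hTlim |>.const_add (Y ω)
  have hP : ∀ n, ∫ p, g (p.1, p.2 / T n) ∂(μ.map fun ω => (X ω, T n * Y ω + N ω)) =
      ∫ ω, g (X ω, (T n * Y ω + N ω) / T n) ∂μ := fun n =>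
    integral_map (hX.prodMk (hZ _)).aemeasurable
      (Measurable.aestronglyMeasurable (by fun_prop))
  have hprod : ∀ {Z : Ω → ℝ}, Measurable Z → (μ.map X).prod (μ.map Z) =
      ((μ.map X).prod μ).map (fun q => (q.1, Z q.2)) := by
    intro Z hZ
    have h1 := Measure.map_prod_map (μ.map X) μ measurable_id hZ
    rwa [Measure.map_id] at h1
  have hQ : ∀ n, ∫ p, (Real.exp (g (p.1, p.2 / T n)) - 1)
        ∂((μ.map X).prod (μ.map fun ω => T n * Y ω + N ω)) =
      ∫ q, (Real.exp (g (q.1, (T n * Y q.2 + N q.2) / T n)) - 1) ∂((μ.map X).prod μ) := by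
    intro n
    rw [hprod (hZ _)]
    exact integral_map (by fun_prop) (Measurable.aestronglyMeasurable (by fun_prop))
  have hP' : ∫ p, g p ∂(μ.map fun ω => (X ω, Y ω)) = ∫ ω, g (X ω, Y ω) ∂μ :=
    integral_map (hX.prodMk hY).aemeasurable hg.aestronglyMeasurable
  have hQ' : ∫ p, (Real.exp (g p) - 1) ∂((μ.map X).prod (μ.map Y)) =
      ∫ q, (Real.exp (g (q.1, Y q.2)) - 1) ∂((μ.map X).prod μ) := by
    rw [hprod hY]
    exact integral_map (by fun_prop) (Measurable.aestronglyMeasurable (by fun_prop))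
  have hlimP : Tendsto (fun n => ∫ ω, g (X ω, (T n * Y ω + N ω) / T n) ∂μ) atTop
      (𝓝 (∫ ω, g (X ω, Y ω) ∂μ)) := by
    refine tendsto_integral_of_dominated_convergence (fun _ => C)
      (fun n => Measurable.aestronglyMeasurable (by fun_prop)) (integrable_const _)
      (fun n => ae_of_all _ fun ω => hC _) (ae_of_all _ fun ω => ?_)
    exact (hg.tendsto _).comp (tendsto_const_nhds.prodMk_nhds (hpt ω))
  have hlimQ : Tendsto (fun n => ∫ q, (Real.exp (g (q.1, (T n * Y q.2 + N q.2) / T n)) - 1)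
      ∂((μ.map X).prod μ)) atTop
      (𝓝 (∫ q, (Real.exp (g (q.1, Y q.2)) - 1) ∂((μ.map X).prod μ))) := by
    refine tendsto_integral_of_dominated_convergence (fun _ => Real.exp C + 1)
      (fun n => Measurable.aestronglyMeasurable (by fun_prop)) (integrable_const _)
      (fun n => ae_of_all _ fun q => ?_) (ae_of_all _ fun q => ?_)
    · refine (norm_sub_le _ _).trans ?_
      rw [Real.norm_of_nonneg (Real.exp_pos _).le, norm_one]
      gcongr
      exact le_of_abs_le (hC _)
    · exact ((Real.continuous_exp.comp hg).tendsto _ |>.comp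
        (tendsto_const_nhds.prodMk_nhds (hpt q.2))).sub_const 1
  rw [hP', hQ'] at hcg
  obtain ⟨n, hn⟩ := ((hlimP.sub hlimQ).eventually_const_lt hcg).exists
  refine ⟨T n, hTpos n, ?_⟩
  have := Measure.isProbabilityMeasure_map (μ := μ) (hX.prodMk (hZ (T n))).aemeasurable
  have := Measure.isProbabilityMeasure_map (μ := μ) (hZ (T n)).aemeasurable
  refine lt_of_lt_of_le ?_ (ofReal_integral_sub_le_klDiv
    (f := fun p : ℝ × ℝ => g (p.1, p.2 / T n)) (by fun_prop) (fun p => hC _))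
  rw [hP, hQ]
  exact (ENNReal.ofReal_lt_ofReal_iff (hc0.trans_lt hn)).2 hn

/-! ### The posterior mean determines the prior -/

lemma integral_tilted_neg_sq (ν : Measure ℝ) (t : ℝ) (g : ℝ → ℝ) :
    ∫ y, g y ∂(ν.tilted fun y => -(t ^ 2 * y ^ 2 / 2)) =
      (∫ y, g y * Real.exp (-(t ^ 2 * y ^ 2 / 2)) ∂ν) /
        ∫ y, Real.exp (-(t ^ 2 * y ^ 2 / 2)) ∂ν := by
  rw [integral_tilted, ← integral_div]
  congr 1; ext y
  rw [smul_eq_mul]; ring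

section

variable (ν : Measure ℝ) [IsProbabilityMeasure ν] {t : ℝ}

lemma integrable_exp_neg_sq (t : ℝ) : Integrable (fun y => Real.exp (-(t ^ 2 * y ^ 2 / 2))) ν := by
  have h := integrable_lik ν t 0
  unfold lik at h
  simpa using h

lemma exp_mul_exp_neg_sq (ht : t ≠ 0) (θ y : ℝ) :
    Real.exp (-(t ^ 2 * y ^ 2 / 2)) * Real.exp (θ * y) = lik t (θ / t) y := by
  rw [lik, ← Real.exp_add]
  congr 1
  field_simp
  ring

lemma integrable_exp_mul_tilted (ht : t ≠ 0) (θ : ℝ) :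
    Integrable (fun y => Real.exp (θ * y)) (ν.tilted fun y => -(t ^ 2 * y ^ 2 / 2)) := by
  rw [integrable_tilted_iff (integrable_exp_neg_sq ν t)]
  simp_rw [smul_eq_mul, exp_mul_exp_neg_sq ht]
  exact integrable_lik ν t _

/-- The posterior mean is the derivative of the cumulant generating function of the prior, tilted
by a Gaussian weight. -/
lemma deriv_cgf_tilted (ht : t ≠ 0) (θ : ℝ) :
    deriv (cgf id (ν.tilted fun y => -(t ^ 2 * y ^ 2 / 2))) θ =
      postMean ν t (θ / t) (fun y => y) := by
  have hset : integrableExpSet id (ν.tilted fun y => -(t ^ 2 * y ^ 2 / 2)) = Set.univ :=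
    Set.eq_univ_of_forall fun θ => integrable_exp_mul_tilted ν ht θ
  have hZ : 0 < ∫ y, Real.exp (-(t ^ 2 * y ^ 2 / 2)) ∂ν :=
    integral_exp_pos (integrable_exp_neg_sq ν t)
  rw [deriv_cgf (by simp [hset]), mgf, postMean, outDens]
  simp only [id]
  rw [integral_tilted_neg_sq, integral_tilted_neg_sq, div_div_div_cancel_right₀ hZ.ne']
  congr 2 <;> ext y <;> rw [← exp_mul_exp_neg_sq ht] <;> ring

variable {ν} in
/-- Two priors with the same posterior means are equal: their Gaussian tilts have the same cumulant
generating function, which is finite everywhere, and the tilt can be undone. -/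
lemma eq_of_postMean_ae_eq {ν' : Measure ℝ} [IsProbabilityMeasure ν'] (ht : t ≠ 0)
    (h : ∀ᵐ z, postMean ν t z (fun y => y) = postMean ν' t z (fun y => y)) : ν = ν' := by
  set f : ℝ → ℝ := fun y => -(t ^ 2 * y ^ 2 / 2) with hf
  have hset : ∀ (η : Measure ℝ) [IsProbabilityMeasure η],
      integrableExpSet id (η.tilted f) = Set.univ := fun η _ =>
    Set.eq_univ_of_forall fun θ => integrable_exp_mul_tilted η ht θ
  have hprob : ∀ (η : Measure ℝ) [IsProbabilityMeasure η], IsProbabilityMeasure (η.tilted f) :=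
    fun η _ => isProbabilityMeasure_tilted (integrable_exp_neg_sq η t)
  have hana : ∀ (η : Measure ℝ) [IsProbabilityMeasure η] (θ : ℝ),
      AnalyticAt ℝ (cgf id (η.tilted f)) θ := fun η _ θ =>
    analyticAt_cgf (by simp [hset η])
  have hcont : ∀ (η : Measure ℝ) [IsProbabilityMeasure η],
      Continuous fun z => postMean η t z (fun y => y) := by
    intro η _
    have h1 : Continuous fun z => deriv (cgf id (η.tilted f)) (t * z) :=
      (continuous_iff_continuousAt.2 fun θ => (hana η θ).deriv.continuousAt).comp
        (continuous_const.mul continuous_id)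
    convert! h1 using 2 with z
    rw [deriv_cgf_tilted η ht, mul_div_cancel_left₀ _ ht]
  have hall : (fun z => postMean ν t z (fun y => y)) = fun z => postMean ν' t z (fun y => y) :=
    ((hcont ν).ae_eq_iff_eq volume (hcont ν')).1 h
  have hp := hprob ν
  have hp' := hprob ν'
  have hcgf : cgf id (ν.tilted f) = cgf id (ν'.tilted f) := by
    have hd : ∀ θ, deriv (cgf id (ν.tilted f) - cgf id (ν'.tilted f)) θ = 0 := by
      intro θ
      rw [deriv_sub (hana ν θ).differentiableAt (hana ν' θ).differentiableAt,
        deriv_cgf_tilted ν ht, deriv_cgf_tilted ν' ht, congrFun hall, sub_self]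
    have hconst := is_const_of_deriv_eq_zero
      (fun θ => ((hana ν θ).sub (hana ν' θ)).differentiableAt) hd
    ext θ
    have := hconst θ 0
    simp only [Pi.sub_apply, cgf_zero, sub_self] at this
    linarith
  have hmgf : mgf id (ν.tilted f) = mgf id (ν'.tilted f) := by
    ext θ
    rw [← exp_cgf (X := id) (integrable_exp_mul_tilted ν ht θ),
      ← exp_cgf (X := id) (integrable_exp_mul_tilted ν' ht θ)]
    exact congrArg Real.exp (congrFun hcgf θ)
  have htilt : ν.tilted f = ν'.tilted f := by
    refine Measure.ext_of_complexMGF_id_eq ?_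
    ext z
    exact eqOn_complexMGF_of_mgf hmgf (by simp [hset ν])
  calc ν = (ν.tilted f).tilted (-f) := (tilted_neg_same (integrable_exp_neg_sq ν t)).symm
    _ = (ν'.tilted f).tilted (-f) := by rw [htilt]
    _ = ν' := tilted_neg_same (integrable_exp_neg_sq ν' t)

end

/-- If side information `V` does not improve the estimation of `Y` from `tY + N`, then `V` and `Y`
are independent. -/
lemma GaussianInput.map_eq_prod_of_integral_condExp_sq_eq {Ω : Type*} [MeasurableSpace Ω]
    {μ : Measure Ω} [IsProbabilityMeasure μ] {V Y N : Ω → ℝ} (h : GaussianInput μ V Y N) {t : ℝ}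
    (ht : t ≠ 0)
    (heq : ∫ ω, ((μ[Y | obsAlg V Y N t]) ω - (μ[Y | obsAlg (fun _ => 0) Y N t]) ω) ^ 2 ∂μ = 0) :
    μ.map (fun ω => (V ω, Y ω)) = (μ.map V).prod (μ.map Y) := by
  have hVp := Measure.isProbabilityMeasure_map (μ := μ) h.measurable_side.aemeasurable
  have hYp := Measure.isProbabilityMeasure_map (μ := μ) h.measurable_input.aemeasurable
  have h0 := h.const_side 0
  have hint : Integrable
      (fun ω => ((μ[Y | obsAlg V Y N t]) ω - (μ[Y | obsAlg (fun _ => 0) Y N t]) ω) ^ 2) μ :=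
    ((memLp_condExp h.memLp_input).sub (memLp_condExp h.memLp_input)).integrable_sq
  rw [integral_eq_zero_iff_of_nonneg (fun ω => sq_nonneg _) hint] at heq
  have hae : ∀ᵐ ω ∂μ, postMean (condDistrib Y V μ (V ω)) t (t * Y ω + N ω) (fun y => y) =
      postMean (μ.map Y) t (t * Y ω + N ω) (fun y => y) := by
    filter_upwards [heq, h.condExp_eq_postMean t, h0.condExp_eq_postMean t] with ω h1 h2 h3
    rw [condDistrib_const_side h.measurable_input] at h3
    rw [← h2, ← h3]
    exact sub_eq_zero.1 (pow_eq_zero_iff two_ne_zero |>.1 h1)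
  have hm1 : Measurable fun p : ℝ × ℝ => postMean (condDistrib Y V μ p.1) t p.2 (fun y => y) :=
    (measurable_postMean_pair (condDistrib Y V μ) t measurable_id).comp measurable_swap
  have hm2 : Measurable fun p : ℝ × ℝ => postMean (μ.map Y) t p.2 (fun y => y) :=
    (measurable_postMean_pair (Kernel.const ℝ (μ.map Y)) t measurable_id).comp measurable_swap
  have hmap : ∀ᵐ p ∂(μ.map fun ω => (V ω, t * Y ω + N ω)),
      postMean (condDistrib Y V μ p.1) t p.2 (fun y => y) =
        postMean (μ.map Y) t p.2 (fun y => y) :=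
    (ae_map_iff (h.measurable_side.prodMk (h.measurable_out t)).aemeasurable
      (measurableSet_eq_fun hm1 hm2)).2 hae
  have hac : (μ.map V).prod (gaussianReal 0 1) ≪ μ.map fun ω => (V ω, t * Y ω + N ω) := by
    rw [h.map_side_out t]
    have hd : Measurable fun p : ℝ × ℝ => outDens (condDistrib Y V μ p.1) t p.2 :=
      (measurable_outDens_pair (condDistrib Y V μ) t).comp measurable_swap
    exact withDensity_absolutelyContinuous' hd.ennreal_ofReal.aemeasurable
      (ae_of_all _ fun p => by simpa using outDens_pos _ _ _)
  have hκ : condDistrib Y V μ =ᵐ[μ.map V] Kernel.const ℝ (μ.map Y) := by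
    filter_upwards [Measure.ae_ae_of_ae_prod (hac hmap)] with v hv
    rw [Kernel.const_apply]
    exact eq_of_postMean_ae_eq ht (gaussianReal_absolutelyContinuous' 0 one_ne_zero hv)
  rw [← compProd_map_condDistrib h.measurable_input.aemeasurable, Measure.compProd_congr hκ,
    Measure.compProd_const]

/-! ### Derivative of one function along another -/

section Param

variable {J A G dJ dA : ℝ → ℝ}

lemma strictMonoOn_of_hasDerivWithinAt
    (hJ : ∀ γ, 0 ≤ γ → HasDerivWithinAt J (dJ γ) (Set.Ici 0) γ)
    (hpos : ∀ γ, 0 < γ → 0 < dJ γ) : StrictMonoOn J (Set.Ici 0) := by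
  refine strictMonoOn_of_deriv_pos (convex_Ici 0)
    (fun γ hγ => (hJ γ hγ).continuousWithinAt) fun γ hγ => ?_
  rw [interior_Ici, Set.mem_Ioi] at hγ
  rw [((hJ γ hγ.le).hasDerivAt (Ici_mem_nhds hγ)).deriv]
  exact hpos γ hγ

lemma monotoneOn_of_hasDerivWithinAt
    (hA : ∀ γ, 0 ≤ γ → HasDerivWithinAt A (dA γ) (Set.Ici 0) γ)
    (hnn : ∀ γ, 0 ≤ γ → 0 ≤ dA γ) : MonotoneOn A (Set.Ici 0) := by
  refine monotoneOn_of_deriv_nonneg (convex_Ici 0)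
    (fun γ hγ => (hA γ hγ).continuousWithinAt)
    (fun γ hγ => ?_) fun γ hγ => ?_
  all_goals rw [interior_Ici, Set.mem_Ioi] at hγ
  · exact ((hA γ hγ.le).hasDerivAt (Ici_mem_nhds hγ)).differentiableAt.differentiableWithinAt
  · rw [((hA γ hγ.le).hasDerivAt (Ici_mem_nhds hγ)).deriv]
    exact hnn γ hγ.le

/-- A continuous strictly increasing function on the half-line has a local right inverse near each
of its values, except possibly its supremum, and this inverse tends to the preimage. -/
lemma exists_local_inverse (hmono : StrictMonoOn J (Set.Ici 0)) (hcont : ContinuousOn J (Set.Ici 0))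
    (h0 : J 0 = 0) {γ T : ℝ} (hγ : 0 ≤ γ) (hT : 0 ≤ T) (hγT : J γ < J T) :
    ∃ inv : ℝ → ℝ, (∀ᶠ e in 𝓝[Set.Ici 0 \ {J γ}] (J γ),
        inv e ∈ Set.Ici 0 \ {γ} ∧ J (inv e) = e) ∧
      Tendsto inv (𝓝[Set.Ici 0 \ {J γ}] (J γ)) (𝓝[Set.Ici 0 \ {γ}] γ) := by
  have hex : ∀ e, ∃ s, 0 ≤ e → e < J T → 0 ≤ s ∧ J s = e := by
    intro e
    by_cases he : 0 ≤ e ∧ e < J T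
    · obtain ⟨s, hs, hse⟩ := intermediate_value_Icc hT (hcont.mono Set.Icc_subset_Ici_self)
        (show e ∈ Set.Icc (J 0) (J T) from ⟨h0.le.trans he.1, he.2.le⟩)
      exact ⟨s, fun _ _ => ⟨hs.1, hse⟩⟩
    · exact ⟨0, fun h1 h2 => absurd ⟨h1, h2⟩ he⟩
  choose inv hinv using hex
  have hev : ∀ᶠ e in 𝓝[Set.Ici 0 \ {J γ}] (J γ), 0 ≤ inv e ∧ J (inv e) = e := by
    filter_upwards [self_mem_nhdsWithin, mem_nhdsWithin_of_mem_nhds (Iio_mem_nhds hγT)]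
      with e he1 he2
    exact hinv e he1.1 he2
  have hev2 : ∀ᶠ e in 𝓝[Set.Ici 0 \ {J γ}] (J γ), inv e ∈ Set.Ici 0 \ {γ} ∧ J (inv e) = e := by
    filter_upwards [hev, self_mem_nhdsWithin] with e he he1
    refine ⟨⟨he.1, fun h => he1.2 ?_⟩, he.2⟩
    rw [Set.mem_singleton_iff] at h ⊢
    rw [← he.2, h]
  refine ⟨inv, hev2, tendsto_nhdsWithin_iff.2 ⟨tendsto_order.2 ⟨fun a ha => ?_, fun a ha => ?_⟩,
    hev2.mono fun e he => he.1⟩⟩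
  · rcases lt_or_ge a 0 with ha0 | ha0
    · exact hev.mono fun e he => ha0.trans_le he.1
    · filter_upwards [hev, mem_nhdsWithin_of_mem_nhds (Ioi_mem_nhds (hmono ha0 hγ ha))]
        with e he he2
      rw [Set.mem_Ioi, ← he.2] at he2
      exact (hmono.lt_iff_lt ha0 he.1).1 he2
  · have ha0 : 0 ≤ a := hγ.trans ha.le
    filter_upwards [hev, mem_nhdsWithin_of_mem_nhds (Iio_mem_nhds (hmono hγ ha0 ha))]
      with e he he2
    rw [Set.mem_Iio, ← he.2] at he2
    exact (hmono.lt_iff_lt he.1 ha0).1 he2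

lemma slope_eq_div_slope (hG : ∀ γ, 0 ≤ γ → G (J γ) = A γ) {γ s : ℝ} (hγ : 0 ≤ γ) (hs : 0 ≤ s)
    (hne : s ≠ γ) : slope G (J γ) (J s) = slope A γ s / slope J γ s := by
  rw [slope_def_field, slope_def_field, slope_def_field, hG γ hγ, hG s hs,
    div_div_div_cancel_right₀ (sub_ne_zero.2 hne)]

/-- If `G ∘ J = A` with `J` increasing, the slopes of `G` are the quotients of those of `A` and `J`. -/
lemma hasDerivWithinAt_param (hmono : StrictMonoOn J (Set.Ici 0))
    (hcont : ContinuousOn J (Set.Ici 0)) (h0 : J 0 = 0) (hG : ∀ γ, 0 ≤ γ → G (J γ) = A γ)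
    {γ T a j : ℝ} (hγ : 0 ≤ γ) (hT : 0 ≤ T) (hγT : J γ < J T)
    (hA : HasDerivWithinAt A a (Set.Ici 0) γ) (hJ : HasDerivWithinAt J j (Set.Ici 0) γ)
    (hj : j ≠ 0) : HasDerivWithinAt G (a / j) (Set.Ici 0) (J γ) := by
  obtain ⟨inv, hinv, hlim⟩ := exists_local_inverse hmono hcont h0 hγ hT hγT
  rw [hasDerivWithinAt_iff_tendsto_slope] at hA hJ ⊢
  refine ((hA.div hJ hj).comp hlim).congr' ?_
  filter_upwards [hinv] with e he
  rw [Function.comp_apply, Pi.div_apply, ← slope_eq_div_slope hG hγ he.1.1 he.1.2, he.2]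

lemma tendsto_slope_param_atTop (hmono : StrictMonoOn J (Set.Ici 0))
    (hcont : ContinuousOn J (Set.Ici 0)) (h0 : J 0 = 0) (hG : ∀ γ, 0 ≤ γ → G (J γ) = A γ)
    {γ T a : ℝ} (hγ : 0 ≤ γ) (hT : 0 ≤ T) (hγT : J γ < J T)
    (hA : HasDerivWithinAt A a (Set.Ici 0) γ) (hJ : HasDerivWithinAt J 0 (Set.Ici 0) γ)
    (ha : 0 < a) : Tendsto (slope G (J γ)) (𝓝[>] (J γ)) atTop := by
  obtain ⟨inv, hinv, hlim⟩ := exists_local_inverse hmono hcont h0 hγ hT hγT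
  rw [hasDerivWithinAt_iff_tendsto_slope] at hA hJ
  have hJ0 : 0 ≤ J γ := h0 ▸ hmono.monotoneOn Set.self_mem_Ici hγ hγ
  have hle : 𝓝[>] (J γ) ≤ 𝓝[Set.Ici 0 \ {J γ}] (J γ) :=
    nhdsWithin_mono _ fun e he => ⟨hJ0.trans (le_of_lt he), ne_of_gt he⟩
  have hpos : Tendsto (fun e => slope J γ (inv e)) (𝓝[>] (J γ)) (𝓝[>] 0) := by
    refine tendsto_nhdsWithin_iff.2 ⟨(hJ.comp hlim).mono_left hle, ?_⟩
    filter_upwards [hle hinv, self_mem_nhdsWithin] with e he he1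
    rw [Set.mem_Ioi, ← he.2] at he1
    have := (hmono.lt_iff_lt hγ he.1.1).1 he1
    rw [Set.mem_Ioi, slope_def_field]
    exact div_pos (sub_pos.2 he1) (sub_pos.2 this)
  refine (((hA.comp hlim).mono_left hle).pos_mul_atTop ha
    (tendsto_inv_nhdsGT_zero.comp hpos)).congr' ?_
  filter_upwards [hle hinv] with e he
  rw [Function.comp_apply, Function.comp_apply, ← div_eq_mul_inv,
    ← slope_eq_div_slope hG hγ he.1.1 he.1.2, he.2]

end Param

/-! ### The rate-privacy function -/

section

variable {Ω : Type*} [MeasurableSpace Ω]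

/-- The mutual information of `V` and `Z_γ` as a real number. -/
noncomputable def realInfo (b : ℝ) (μ : Measure Ω) [IsFiniteMeasure μ] (V Y N : Ω → ℝ) (γ : ℝ) :
    ℝ :=
  (meanLogDens μ V Y N (√γ) - meanLogDens μ (fun _ => 0) Y N (√γ)) / Real.log b

lemma mmse_nonneg {β : Type*} [MeasurableSpace β] (U : Ω → ℝ) (V : Ω → β) (μ : Measure Ω) :
    0 ≤ mmse U V μ :=
  integral_nonneg fun _ => sq_nonneg _

end

lemma comap_out_const {Ω : Type*} (Y N : Ω → ℝ) (t : ℝ) :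
    obsAlg (fun _ => 0) Y N t = MeasurableSpace.comap (fun ω => t * Y ω + N ω) inferInstance := by
  refine le_antisymm ?_ ?_
  · exact ((comap_measurable fun ω => t * Y ω + N ω).prodMk measurable_const).comap_le
  · exact (measurable_fst.comp
      (comap_measurable fun ω => (t * Y ω + N ω, (0 : ℝ)))).comap_le

lemma obsAlg_const_le {Ω : Type*} (V Y N : Ω → ℝ) (t : ℝ) : obsAlg (fun _ => 0) Y N t ≤ obsAlg V Y N t := by
  rw [comap_out_const]
  exact (measurable_fst.comp (comap_measurable fun ω => (t * Y ω + N ω, V ω))).comap_le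

namespace GaussianInput

variable {Ω : Type*} [MeasurableSpace Ω] {μ : Measure Ω} [IsProbabilityMeasure μ] {V Y N : Ω → ℝ}

lemma mmse_pair (h : GaussianInput μ V Y N) (γ : ℝ) :
    mmse Y (fun ω => (channel Y N γ ω, V ω)) μ =
      ∫ ω, Y ω ^ 2 ∂μ - ∫ ω, (μ[Y | obsAlg V Y N (√γ)]) ω ^ 2 ∂μ :=
  integral_sub_condExp_sq (h.obsAlg_le (√γ)) h.memLp_input

lemma mmse_channel (h : GaussianInput μ V Y N) (γ : ℝ) :
    mmse Y (channel Y N γ) μ =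
      ∫ ω, Y ω ^ 2 ∂μ - ∫ ω, (μ[Y | obsAlg (fun _ => 0) Y N (√γ)]) ω ^ 2 ∂μ := by
  rw [← (h.const_side 0).mmse_pair]
  unfold mmse
  have := comap_out_const Y N (√γ)
  unfold obsAlg at this
  unfold channel
  rw [this]

lemma integral_condExp_self_side (h : GaussianInput μ V Y N) (t : ℝ) :
    ∫ ω, (μ[Y | obsAlg Y Y N t]) ω ^ 2 ∂μ = ∫ ω, Y ω ^ 2 ∂μ := by
  have hm : Measurable[obsAlg Y Y N t] Y :=
    measurable_snd.comp (comap_measurable fun ω => (t * Y ω + N ω, Y ω))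
  rw [condExp_of_stronglyMeasurable (h.self_side.obsAlg_le t) hm.stronglyMeasurable
    (h.memLp_input.integrable one_le_two)]

/-- The advantage of side information is the mean square difference of the two estimators. -/
lemma mmse_sub_mmse (h : GaussianInput μ V Y N) (γ : ℝ) :
    mmse Y (channel Y N γ) μ - mmse Y (fun ω => (channel Y N γ ω, V ω)) μ =
      ∫ ω, ((μ[Y | obsAlg V Y N (√γ)]) ω -
        (μ[Y | obsAlg (fun _ => 0) Y N (√γ)]) ω) ^ 2 ∂μ := by
  rw [h.mmse_channel, h.mmse_pair, integral_condExp_sub_sq (obsAlg_const_le V Y N _)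
    (h.obsAlg_le _) h.memLp_input]
  ring

lemma mmse_sub_mmse_nonneg (h : GaussianInput μ V Y N) (γ : ℝ) :
    0 ≤ mmse Y (channel Y N γ) μ - mmse Y (fun ω => (channel Y N γ ω, V ω)) μ := by
  rw [h.mmse_sub_mmse]
  exact integral_nonneg fun ω => sq_nonneg _

lemma mmse_sub_mmse_pos (h : GaussianInput μ V Y N)
    (hdep : μ.map (fun ω => (V ω, Y ω)) ≠ (μ.map V).prod (μ.map Y)) {γ : ℝ} (hγ : 0 < γ) :
    0 < mmse Y (channel Y N γ) μ - mmse Y (fun ω => (channel Y N γ ω, V ω)) μ := by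
  refine (h.mmse_sub_mmse_nonneg γ).lt_of_ne fun h0 => hdep ?_
  rw [h.mmse_sub_mmse] at h0
  exact h.map_eq_prod_of_integral_condExp_sq_eq (Real.sqrt_pos.2 hγ).ne' h0.symm

/-- Without a signal, only a constant input has mean square error zero. -/
lemma mmse_channel_zero_pos (h : GaussianInput μ V Y N)
    (hdep : μ.map (fun ω => (V ω, Y ω)) ≠ (μ.map V).prod (μ.map Y)) :
    0 < mmse Y (channel Y N 0) μ := by
  refine (mmse_nonneg _ _ _).lt_of_ne fun h0 => hdep ?_
  have h1 := (h.const_side 0).condExp_zero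
  have h2 : MeasurableSpace.comap (fun _ : Ω => (0 : ℝ)) inferInstance = ⊥ :=
    MeasurableSpace.comap_const _
  rw [h2, condExp_bot] at h1
  have hint : Integrable
      (fun ω => (Y ω - (μ[Y | obsAlg (fun _ => 0) Y N 0]) ω) ^ 2) μ :=
    (h.memLp_input.sub (memLp_condExp h.memLp_input)).integrable_sq
  rw [h.mmse_channel, Real.sqrt_zero,
    ← integral_sub_condExp_sq ((h.const_side 0).obsAlg_le 0) h.memLp_input, eq_comm,
    integral_eq_zero_iff_of_nonneg (fun ω => sq_nonneg _) hint] at h0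
  have hY : (fun _ => ∫ ω, Y ω ∂μ) =ᵐ[μ] Y := by
    filter_upwards [h0, h1] with ω h3 h4
    have h5 := sub_eq_zero.1 (pow_eq_zero_iff two_ne_zero |>.1 h3)
    rw [h5, h4]
  exact (indepFun_iff_map_prod_eq_prod_map_map h.measurable_side.aemeasurable
    h.measurable_input.aemeasurable).1
    ((indepFun_const_right V _).congr EventuallyEq.rfl hY)

variable (μ V Y N) in
lemma meanLogDens_zero : meanLogDens μ V Y N 0 = 0 := by
  simp [meanLogDens, outDens, lik]

variable {b : ℝ}

lemma realInfo_nonneg (h : GaussianInput μ V Y N) (hb : 1 < b) (γ : ℝ) :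
    0 ≤ realInfo b μ V Y N γ :=
  div_nonneg (h.mutualInfo_eq hb (√γ)).2 (Real.log_pos hb).le

lemma mutualInfo_channel (h : GaussianInput μ V Y N) (hb : 1 < b) (γ : ℝ) :
    mutualInfo b V (channel Y N γ) μ = ENNReal.ofReal (realInfo b μ V Y N γ) :=
  (h.mutualInfo_eq hb (√γ)).1

variable (b μ V Y N) in
lemma realInfo_zero : realInfo b μ V Y N 0 = 0 := by
  simp [realInfo, meanLogDens_zero]

/-- The **I-MMSE relation** with side information. -/
lemma hasDerivWithinAt_realInfo (h : GaussianInput μ V Y N) {γ : ℝ} (hγ : 0 ≤ γ) :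
    HasDerivWithinAt (realInfo b μ V Y N)
      ((mmse Y (channel Y N γ) μ - mmse Y (fun ω => (channel Y N γ ω, V ω)) μ) /
        (2 * Real.log b)) (Set.Ici 0) γ := by
  convert! ((h.hasDerivWithinAt_meanLogDens_sqrt hγ).sub
    ((h.const_side 0).hasDerivWithinAt_meanLogDens_sqrt hγ)).div_const (Real.log b) using 1
  rw [h.mmse_channel, h.mmse_pair]
  field_simp
  ring

/-- The **I-MMSE relation** of Guo, Shamai and Verdú. -/
lemma hasDerivWithinAt_realInfo_self (h : GaussianInput μ V Y N) {γ : ℝ} (hγ : 0 ≤ γ) :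
    HasDerivWithinAt (realInfo b μ Y Y N) (mmse Y (channel Y N γ) μ / (2 * Real.log b))
      (Set.Ici 0) γ := by
  have h1 := h.self_side.hasDerivWithinAt_realInfo (b := b) hγ
  rwa [h.self_side.mmse_pair, h.integral_condExp_self_side, sub_self, sub_zero] at h1

lemma exists_lt_realInfo (h : GaussianInput μ V Y N) (hb : 1 < b) {ε : ℝ} (hε0 : 0 ≤ ε)
    (hε : ENNReal.ofReal ε < mutualInfo b V Y μ) :
    ∃ T, 0 ≤ T ∧ ε < realInfo b μ V Y N T := by
  have hlog := Real.log_pos hb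
  have hl0 : ENNReal.ofReal (Real.log b) ≠ 0 := by simpa using hlog
  rw [mutualInfo, ENNReal.lt_div_iff_mul_lt (Or.inl hl0) (Or.inl ENNReal.ofReal_ne_top),
    ← ENNReal.ofReal_mul hε0] at hε
  obtain ⟨t, ht, hlt⟩ := exists_lt_klDiv_out h.measurable_side h.measurable_input
    h.measurable_noise hε (by positivity)
  refine ⟨t ^ 2, sq_nonneg t, ?_⟩
  have h1 := h.mutualInfo_channel hb (t ^ 2)
  rw [ENNReal.ofReal_mul hε0,
    ← ENNReal.lt_div_iff_mul_lt (Or.inl hl0) (Or.inl ENNReal.ofReal_ne_top)] at hlt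
  unfold channel at h1
  rw [Real.sqrt_sq ht.le] at h1
  change ENNReal.ofReal ε < mutualInfo b V (fun ω => t * Y ω + N ω) μ at hlt
  rw [h1] at hlt
  exact lt_of_not_ge fun hle => absurd (ENNReal.ofReal_le_ofReal hle) (not_le.2 hlt)

lemma isGreatest_admissibleRates (h : GaussianInput μ V Y N) (hb : 1 < b)
    (hmono : StrictMonoOn (realInfo b μ V Y N) (Set.Ici 0)) {γ : ℝ} (hγ : 0 ≤ γ) :
    IsGreatest (admissibleRates b V Y N μ (realInfo b μ V Y N γ))
      (ENNReal.ofReal (realInfo b μ Y Y N γ)) := by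
  refine ⟨⟨γ, hγ, (h.mutualInfo_channel hb γ).le, (h.self_side.mutualInfo_channel hb γ).symm⟩, ?_⟩
  rintro r ⟨s, hs, hle, rfl⟩
  rw [h.mutualInfo_channel hb, ENNReal.ofReal_le_ofReal_iff (h.realInfo_nonneg hb γ)] at hle
  rw [h.self_side.mutualInfo_channel hb]
  refine ENNReal.ofReal_le_ofReal ?_
  refine monotoneOn_of_hasDerivWithinAt (fun γ hγ => h.hasDerivWithinAt_realInfo_self (b := b) hγ)
    (fun γ _ => div_nonneg (mmse_nonneg _ _ _) ?_) hs hγ ((hmono.le_iff_le hs hγ).1 hle)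
  have := Real.log_pos hb
  positivity

end GaussianInput

end RatePrivacy

theorem theorem1 {Ω : Type*} [MeasurableSpace Ω] (μ : Measure Ω) [IsProbabilityMeasure μ]
    (X Y N : Ω → ℝ) (hX : Measurable X) (hY : Measurable Y) (hN : Measurable N)
    -- the pair `(X, Y)` is absolutely continuous, and `Y` has finite variance
    (hXY : μ.map (fun ω => (X ω, Y ω)) ≪ (volume : Measure (ℝ × ℝ)))
    (hY2 : MemLp Y 2 μ)
    -- the noise is standard Gaussian and independent of `(X, Y)`
    (hNlaw : μ.map N = gaussianReal 0 1)
    (hNind : IndepFun (fun ω => (X ω, Y ω)) N μ)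
    -- `b` is the base of the logarithms, `ε ∈ [0, I(X;Y))`
    (b : ℝ) (hb : 1 < b) (ε : ℝ) (hε0 : 0 ≤ ε)
    (hε : ENNReal.ofReal ε < RatePrivacy.mutualInfo b X Y μ) :
    -- there is exactly one `γ_ε`
    (∃! γ : ℝ, 0 ≤ γ ∧
      RatePrivacy.mutualInfo b X (RatePrivacy.channel Y N γ) μ = ENNReal.ofReal ε) ∧
    ∀ γ : ℝ, 0 ≤ γ →
      RatePrivacy.mutualInfo b X (RatePrivacy.channel Y N γ) μ = ENNReal.ofReal ε →
      -- the maximum that defines `g_ε` is attained at `γ_ε`, and it is finite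
      IsGreatest (RatePrivacy.admissibleRates b X Y N μ ε)
        (RatePrivacy.mutualInfo b Y (RatePrivacy.channel Y N γ) μ) ∧
      RatePrivacy.ratePrivacy b X Y N μ ε ≠ ∞ ∧
      -- the denominator is nonnegative, and it can vanish only if `ε = 0`
      0 ≤ RatePrivacy.mmse Y (RatePrivacy.channel Y N γ) μ -
        RatePrivacy.mmse Y (fun ω => (RatePrivacy.channel Y N γ ω, X ω)) μ ∧
      (0 < ε → 0 < RatePrivacy.mmse Y (RatePrivacy.channel Y N γ) μ -
        RatePrivacy.mmse Y (fun ω => (RatePrivacy.channel Y N γ ω, X ω)) μ) ∧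
      -- the derivative (two-sided if `0 < ε`, from the right if `ε = 0`)
      (RatePrivacy.mmse Y (RatePrivacy.channel Y N γ) μ -
          RatePrivacy.mmse Y (fun ω => (RatePrivacy.channel Y N γ ω, X ω)) μ ≠ 0 →
        HasDerivWithinAt (fun e : ℝ => (RatePrivacy.ratePrivacy b X Y N μ e).toReal)
          (RatePrivacy.mmse Y (RatePrivacy.channel Y N γ) μ /
            (RatePrivacy.mmse Y (RatePrivacy.channel Y N γ) μ -
              RatePrivacy.mmse Y (fun ω => (RatePrivacy.channel Y N γ ω, X ω)) μ))
          (Set.Ici 0) ε) ∧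
      -- if the denominator vanishes, the derivative is `+∞`, as the quotient says
      (RatePrivacy.mmse Y (RatePrivacy.channel Y N γ) μ -
          RatePrivacy.mmse Y (fun ω => (RatePrivacy.channel Y N γ ω, X ω)) μ = 0 →
        0 < RatePrivacy.mmse Y (RatePrivacy.channel Y N γ) μ ∧
        Tendsto (slope (fun e : ℝ => (RatePrivacy.ratePrivacy b X Y N μ e).toReal) ε)
          (𝓝[>] ε) atTop) := by
  have h : RatePrivacy.GaussianInput μ X Y N := ⟨hX, hY, hN, hY2, hNlaw, hNind⟩
  have hlog := Real.log_pos hb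
  have hdep : μ.map (fun ω => (X ω, Y ω)) ≠ (μ.map X).prod (μ.map Y) := by
    intro heq
    have := Measure.isProbabilityMeasure_map (μ := μ) hX.aemeasurable
    have := Measure.isProbabilityMeasure_map (μ := μ) hY.aemeasurable
    rw [RatePrivacy.mutualInfo, heq, InformationTheory.klDiv_self, ENNReal.zero_div] at hε
    exact not_lt_zero hε
  set J := RatePrivacy.realInfo b μ X Y N with hJdef
  set A := RatePrivacy.realInfo b μ Y Y N with hAdef
  have hJder := fun γ (hγ : 0 ≤ γ) => h.hasDerivWithinAt_realInfo (b := b) hγ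
  have hAder := fun γ (hγ : 0 ≤ γ) => h.hasDerivWithinAt_realInfo_self (b := b) hγ
  have hmono : StrictMonoOn J (Set.Ici 0) :=
    RatePrivacy.strictMonoOn_of_hasDerivWithinAt hJder fun γ hγ =>
      div_pos (h.mmse_sub_mmse_pos hdep hγ) (by positivity)
  have hcont : ContinuousOn J (Set.Ici 0) := fun γ hγ => (hJder γ hγ).continuousWithinAt
  have hJ0 : J 0 = 0 := RatePrivacy.GaussianInput.realInfo_zero μ X Y N b
  have hval : ∀ γ, RatePrivacy.mutualInfo b X (RatePrivacy.channel Y N γ) μ = ENNReal.ofReal ε →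
      J γ = ε := by
    intro γ hγ
    rw [h.mutualInfo_channel hb] at hγ
    exact (ENNReal.ofReal_eq_ofReal_iff (h.realInfo_nonneg hb γ) hε0).1 hγ
  obtain ⟨T, hT, hεT⟩ := h.exists_lt_realInfo hb hε0 hε
  have hG : ∀ γ, 0 ≤ γ → (RatePrivacy.ratePrivacy b X Y N μ (J γ)).toReal = A γ := by
    intro γ hγ
    rw [RatePrivacy.ratePrivacy, (h.isGreatest_admissibleRates hb hmono hγ).csSup_eq,
      ENNReal.toReal_ofReal (h.self_side.realInfo_nonneg hb γ)]
  constructor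
  · obtain ⟨γ, hγ, hγε⟩ := intermediate_value_Icc hT (hcont.mono Set.Icc_subset_Ici_self)
      (show ε ∈ Set.Icc (J 0) (J T) from ⟨hJ0.le.trans hε0, hεT.le⟩)
    refine ⟨γ, ⟨hγ.1, ?_⟩, fun s hs => hmono.injOn hs.1 hγ.1 ((hval s hs.2).trans hγε.symm)⟩
    rw [h.mutualInfo_channel hb, ← hJdef, hγε]
  · intro γ hγ hγε
    obtain rfl := hval γ hγε
    have hgr := h.isGreatest_admissibleRates hb hmono hγ
    refine ⟨?_, ?_, h.mmse_sub_mmse_nonneg γ, fun hpos => ?_, fun hne => ?_, fun hz => ?_⟩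
    · rw [h.self_side.mutualInfo_channel hb]
      exact hgr
    · rw [RatePrivacy.ratePrivacy, hgr.csSup_eq]
      exact ENNReal.ofReal_ne_top
    · refine h.mmse_sub_mmse_pos hdep (hγ.lt_of_ne ?_)
      rintro rfl
      exact hpos.ne' hJ0
    · have := RatePrivacy.hasDerivWithinAt_param
        (G := fun e => (RatePrivacy.ratePrivacy b X Y N μ e).toReal) hmono hcont hJ0 hG hγ hT hεT (hAder γ hγ)
        (hJder γ hγ) (div_ne_zero hne (by positivity))
      rwa [div_div_div_cancel_right₀ (by positivity)] at this
    · have hγ0 : γ = 0 := by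
        by_contra hne
        exact (h.mmse_sub_mmse_pos hdep (hγ.lt_of_ne (Ne.symm hne))).ne' hz
      have hnum : 0 < RatePrivacy.mmse Y (RatePrivacy.channel Y N γ) μ := by
        rw [hγ0]
        exact h.mmse_channel_zero_pos hdep
      refine ⟨hnum, ?_⟩
      have hJγ := hJder γ hγ
      rw [hz, zero_div] at hJγ
      exact RatePrivacy.tendsto_slope_param_atTop
        (G := fun e => (RatePrivacy.ratePrivacy b X Y N μ e).toReal) hmono hcont hJ0 hG hγ hT hεT (hAder γ hγ) hJγ
        (div_pos hnum (by positivity))
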